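/- Let $\alpha\in(0,2)$, $\nu>0$ and let $n\ge 1$ be an integer. There is a function $q_{\alpha,\nu,n}$ (unique on $(0,\infty)$), continuous on $(0,\infty)$, such that $\mathbf{x}\mapsto q_{\alpha,\nu,n}(\Vert\mathbf{x}\Vert)$ is a probability density on $\mathbb{R}^n$ with characteristic function $$\int_{\mathbb{R}^n}e^{i\mathbf{x}\cdot\boldsymbol{t}}\,q_{\alpha,\nu,n}(\Vert\mathbf{x}\Vert)\,d^n\mathbf{x}=\frac{1}{(1+\Vert\boldsymbol{t}\Vert^{\alpha})^{\nu}},\qquad \boldsymbol{t}\in\mathbb{R}^n,$$ where $\Vert\cdot\Vert$ is the Euclidean norm (the symmetric $n$-variate generalized Linnik density). For every integer $N\ge 1$ and every $r>0$, $$q_{\alpha,\nu,n}(r)=\frac{1}{\pi^{\frac{n+2}{2}}}\sum_{j=1}^{N-1}\frac{(-1)^{j-1}}{j!}\frac{\Gamma(\nu+j)}{\Gamma(\nu)}\sin\frac{\pi\alpha j}{2}\,2^{\alpha j}\,\Gamma\left(\frac{n+\alpha j}{2}\right)\Gamma\left(\frac{2+\alpha j}{2}\right)r^{-\alpha j-n}+\mathcal{R}_N(r),$$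 where $$|\mathcal{R}_N(r)|\le\frac{2^{\alpha N}\,\Gamma(N+\nu)\,\Gamma\left(\frac{n+\alpha N}{2}\right)\Gamma\left(\frac{2+\alpha N}{2}\right)}{\pi^{\frac{n+2}{2}}\,N!\,\Gamma(\nu)\,\sin^{\nu+N}\frac{\pi\alpha}{2}}\,r^{-\alpha N-n}.$$ In particular, as $r\to\infty$, $$q_{\alpha,\nu,n}(r)\sim\frac{2^{\alpha}\nu}{\pi^{\frac{n+2}{2}}}\sin\frac{\pi\alpha}{2}\,\Gamma\left(\frac{n+\alpha}{2}\right)\Gamma\left(\frac{2+\alpha}{2}\right)r^{-\alpha-n}.$$ -/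

import Mathlib

open MeasureTheory Set

/-- The characteristic function `t ↦ (1 + ‖t‖ ^ α) ^ (-ν)` of the `n`-variate symmetric
generalized Linnik distribution. -/
noncomputable def linnikCharFun (α ν : ℝ) (n : ℕ) (t : EuclideanSpace ℝ (Fin n)) : ℝ :=
  1 / (1 + ‖t‖ ^ α) ^ ν

/-- `p` is a density, with respect to Lebesgue measure on `ℝⁿ`, of the probability distribution
with characteristic function `(1 + ‖t‖ ^ α) ^ (-ν)`. The condition at `t = 0` says that the
total mass is one. -/
structure IsLinnikDensity (α ν : ℝ) (n : ℕ) (p : EuclideanSpace ℝ (Fin n) → ℝ) : Prop where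
  aemeasurable : AEMeasurable p
  nonneg : ∀ᵐ x, 0 ≤ p x
  charFun_eq : ∀ t : EuclideanSpace ℝ (Fin n),
    charFun (volume.withDensity fun x => ENNReal.ofReal (p x)) t = (linnikCharFun α ν n t : ℂ)

/-- `q` is the radial profile of the generalized Linnik density: `x ↦ q ‖x‖` is a density of the
distribution, in the version that is continuous away from the origin (the density may be
unbounded at the origin, so the value `q 0` plays no role). -/
structure IsLinnikRadialDensity (α ν : ℝ) (n : ℕ) (q : ℝ → ℝ) : Prop where
  continuousOn : ContinuousOn q (Ioi 0)
  isLinnikDensity : IsLinnikDensity α ν n fun x => q ‖x‖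

/-- The coefficient of `r ^ (-α * j - n)` in the large-`r` expansion. -/
noncomputable def linnikCoeff (α ν : ℝ) (n j : ℕ) : ℝ :=
  1 / Real.pi ^ (((n : ℝ) + 2) / 2) *
    ((-1) ^ (j - 1) / (j.factorial : ℝ) * (Real.Gamma (ν + j) / Real.Gamma ν) *
      Real.sin (Real.pi * α * j / 2) * 2 ^ (α * j) *
      Real.Gamma ((n + α * j) / 2) * Real.Gamma ((2 + α * j) / 2))

/-- The coefficient of `r ^ (-α * N - n)` in the bound of the `N`-th remainder. -/
noncomputable def linnikRemainderConst (α ν : ℝ) (n N : ℕ) : ℝ :=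
  2 ^ (α * N) * Real.Gamma (N + ν) * Real.Gamma ((n + α * N) / 2) *
      Real.Gamma ((2 + α * N) / 2) /
    (Real.pi ^ (((n : ℝ) + 2) / 2) * (N.factorial : ℝ) * Real.Gamma ν *
      Real.sin (Real.pi * α / 2) ^ (ν + N))

/-! Put `b = α / 2 ∈ (0, 1)`. The density is a mixture of centred Gaussians: if `g` has Laplace
transform `c ↦ (1 + c ^ b) ^ (-ν)`, then evaluating at `c = ‖t‖ ^ 2` shows that averaging the heat
kernels with weight `g u du` gives characteristic function `(1 + ‖t‖ ^ α) ^ (-ν)`.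

The weight is explicit. Cauchy's theorem on the plane cut along the negative axis gives the
Stieltjes representation `(1 + c ^ b) ^ (-ν) = π⁻¹ ∫ J y / (y + c) dy`
(`integral_linnikJump_div_add`), where `J y` is the imaginary part of `(1 + y ^ b * exp (-iπb)) ^
(-ν)`. Since `1 / (y + c)` is itself a Laplace transform, `g u = π⁻¹ ∫ exp (-u y) J y dy`.

The expansion is the binomial series of `J` in powers of `y ^ b`, integrated twice against positive
kernels: `exp (-u y)` in `y`, then the heat kernel in `u`. Each integration yields a Gamma factor
and carries the absolute error bound along. The bound comes from `norm_negBinomRemainder_le`: the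
ray `1 + t z` in direction `exp (-iπb)` stays at distance at least `sin (πb)` from `0`, so Taylor's
estimate holds for every `y`, also where the series diverges.

Positivity is direct for `ν ≤ 1`, where `J ≥ 0`. For larger `ν` it follows by repeated halving,
because the law for `ν` is the convolution square of the law for `ν / 2`
(`linnikProfile_ae_nonneg`). Uniqueness comes from injectivity of characteristic functions together
with continuity. -/

open Filter Topology

/-! ### Binomial series with a remainder bound along a ray -/

/-- The absolute value `Γ(ν + j) / (Γ(ν) j!)` of the `j`-th binomial coefficient of `-ν`. -/
noncomputable def negBinomCoeff (ν : ℝ) (j : ℕ) : ℝ :=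
  Real.Gamma (ν + j) / Real.Gamma ν / (j.factorial : ℝ)

lemma negBinomCoeff_zero {ν : ℝ} (hν : 0 < ν) : negBinomCoeff ν 0 = 1 := by
  simp [negBinomCoeff, (Real.Gamma_pos_of_pos hν).ne']

lemma succ_mul_negBinomCoeff {ν : ℝ} (hν : 0 < ν) (j : ℕ) :
    ((j : ℝ) + 1) * negBinomCoeff ν (j + 1) = ν * negBinomCoeff (ν + 1) j := by
  have h1 := (Real.Gamma_pos_of_pos hν).ne'
  unfold negBinomCoeff
  rw [Real.Gamma_add_one hν.ne', Nat.factorial_succ]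
  push_cast
  rw [show ν + 1 + j = ν + (j + 1) by ring]
  have : (j.factorial : ℝ) ≠ 0 := by positivity
  have : (j : ℝ) + 1 ≠ 0 := by positivity
  field_simp

/-- The remainder of the binomial series of `(1 + t z) ^ (-ν)` after `N` terms. -/
noncomputable def negBinomRemainder (ν : ℝ) (N : ℕ) (z : ℂ) (t : ℝ) : ℂ :=
  (1 + t * z) ^ (-(ν : ℂ)) - ∑ j ∈ Finset.range N, (-1) ^ j * (negBinomCoeff ν j : ℂ) * (t * z) ^ j

/-- Differentiation trades one order of the remainder for one unit of the exponent;
`succ_mul_negBinomCoeff` matches the coefficients. This drives the induction for the remainder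
bound. -/
lemma hasDerivAt_negBinomRemainder {ν : ℝ} (hν : 0 < ν) (N : ℕ) {z : ℂ} {t : ℝ}
    (ht : 1 + t * z ∈ Complex.slitPlane) :
    HasDerivAt (negBinomRemainder ν (N + 1) z) (-ν * z * negBinomRemainder (ν + 1) N z t) t := by
  have hl : HasDerivAt (fun t : ℝ => (t : ℂ) * z) z t := by
    simpa using (Complex.ofRealCLM.hasDerivAt (x := t)).mul_const z
  have h1 : HasDerivAt (fun t : ℝ => (1 + (t : ℂ) * z) ^ (-(ν : ℂ)))
      (-(ν : ℂ) * (1 + t * z) ^ (-(ν : ℂ) - 1) * z) t :=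
    HasDerivAt.comp (h₂ := fun w : ℂ => w ^ (-(ν : ℂ))) t
      (Complex.hasStrictDerivAt_cpow_const ht).hasDerivAt (hl.const_add 1)
  have h2 : HasDerivAt (fun t : ℝ => ∑ j ∈ Finset.range (N + 1),
      (-1) ^ j * (negBinomCoeff ν j : ℂ) * ((t : ℂ) * z) ^ j)
      (∑ j ∈ Finset.range (N + 1),
        (-1) ^ j * (negBinomCoeff ν j : ℂ) * (j * ((t : ℂ) * z) ^ (j - 1) * z)) t :=
    HasDerivAt.fun_sum fun j _ => (hl.pow j).const_mul _
  refine (h1.sub h2).congr_deriv (Eq.symm ?_)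
  rw [Finset.sum_range_succ']
  simp only [negBinomRemainder, mul_sub, Finset.mul_sum]
  congr 1
  · push_cast
    rw [neg_add, ← sub_eq_add_neg]
    ring
  · simp only [CharP.cast_eq_zero, zero_mul, mul_zero, add_zero]
    refine Finset.sum_congr rfl fun j _ => ?_
    have := congrArg (fun x : ℝ => (x : ℂ)) (succ_mul_negBinomCoeff hν j)
    push_cast at this ⊢
    simp only [pow_succ]
    linear_combination (-1) ^ j * z * (t * z) ^ j * this

lemma negBinomRemainder_succ_zero {ν : ℝ} (hν : 0 < ν) (N : ℕ) (z : ℂ) :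
    negBinomRemainder ν (N + 1) z 0 = 0 := by
  simp [negBinomRemainder, Finset.sum_range_succ', negBinomCoeff_zero hν]

/-- Induction on `N` for all `ν` at once: the derivative has order `N` and exponent `ν + 1`, so the
power `ν + N` of `s` is preserved. The lower bound `s` enters only for `N = 0`. -/
lemma norm_negBinomRemainder_le (N : ℕ) {ν s : ℝ} (hν : 0 < ν) (hs : 0 < s) {z : ℂ}
    (hz : ∀ t : ℝ, 0 ≤ t → 1 + t * z ∈ Complex.slitPlane)
    (hsz : ∀ t : ℝ, 0 ≤ t → s ≤ ‖1 + t * z‖) {t : ℝ} (ht : 0 ≤ t) :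
    ‖negBinomRemainder ν N z t‖ ≤ negBinomCoeff ν N * (t * ‖z‖) ^ N / s ^ (ν + N) := by
  induction N generalizing ν t with
  | zero =>
    simp only [negBinomRemainder, Finset.range_zero, Finset.sum_empty, sub_zero,
      negBinomCoeff_zero hν, pow_zero, mul_one, CharP.cast_eq_zero, add_zero]
    rw [← Complex.ofReal_neg, Complex.norm_cpow_real, Real.rpow_neg (norm_nonneg _), one_div]
    gcongr
    exact hsz t ht
  | succ N ih =>
    have key : ∀ ⦃x⦄, x ∈ Icc (0 : ℝ) t → ‖negBinomRemainder ν (N + 1) z x‖ ≤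
        negBinomCoeff ν (N + 1) * ‖z‖ ^ (N + 1) / s ^ (ν + (N + 1 : ℕ)) * x ^ (N + 1) := by
      -- Comparison with the monomial whose derivative dominates replaces an integral form of the
      -- remainder.
      apply image_norm_le_of_norm_deriv_right_le_deriv_boundary
        (f := negBinomRemainder ν (N + 1) z)
        (B := fun x => negBinomCoeff ν (N + 1) * ‖z‖ ^ (N + 1) / s ^ (ν + (N + 1 : ℕ)) * x ^ (N + 1))
        (f' := fun x => -ν * z * negBinomRemainder (ν + 1) N z x)
        (B' := fun x => negBinomCoeff ν (N + 1) * ‖z‖ ^ (N + 1) / s ^ (ν + (N + 1 : ℕ)) *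
          (((N + 1 : ℕ) : ℝ) * x ^ N))
      · exact fun x hx => (hasDerivAt_negBinomRemainder hν N
          (hz x hx.1)).continuousAt.continuousWithinAt
      · exact fun x hx => (hasDerivAt_negBinomRemainder hν N (hz x hx.1)).hasDerivWithinAt
      · simp [negBinomRemainder_succ_zero hν]
      · intro x
        simpa using (hasDerivAt_pow (N + 1) x).const_mul _
      · intro x hx
        have h := ih (ν := ν + 1) (by positivity) hx.1
        rw [norm_mul, norm_mul, norm_neg, Complex.norm_real, Real.norm_of_nonneg hν.le]
        calc ν * ‖z‖ * ‖negBinomRemainder (ν + 1) N z x‖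
            ≤ ν * ‖z‖ * (negBinomCoeff (ν + 1) N * (x * ‖z‖) ^ N / s ^ (ν + 1 + N)) := by gcongr
          _ = _ := by
            have := succ_mul_negBinomCoeff hν N
            rw [show ν + 1 + (N : ℝ) = ν + ((N + 1 : ℕ) : ℝ) by push_cast; ring]
            push_cast at this ⊢
            rw [mul_pow, pow_succ]
            linear_combination (-(‖z‖ * x ^ N * ‖z‖ ^ N / s ^ (ν + (N + 1)))) * this
    refine (key ⟨ht, le_rfl⟩).trans_eq ?_
    rw [mul_pow]
    ring

/-! ### Distance of a ray from the origin -/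

/-- Rotating by `exp (-iφ)` makes the `ρ` term real, so the imaginary part is `-sin φ` whatever `ρ`
is. -/
lemma abs_sin_le_norm_one_add (ρ φ : ℝ) :
    |Real.sin φ| ≤ ‖1 + ρ * Complex.exp (φ * Complex.I)‖ := by
  have h : ‖1 + ρ * Complex.exp (φ * Complex.I)‖ = ‖Complex.exp ((-φ : ℝ) * Complex.I) + ρ‖ := by
    rw [← mul_one ‖1 + _‖, ← Complex.norm_exp_ofReal_mul_I (-φ), ← norm_mul, add_mul, one_mul,
      mul_assoc, ← Complex.exp_add]
    simp
  rw [h]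
  refine le_trans (le_of_eq ?_) (Complex.abs_im_le_norm _)
  rw [Complex.add_im, Complex.exp_ofReal_mul_I_im]
  simp

lemma mul_abs_sin_le_norm_one_add {ρ : ℝ} (hρ : 0 ≤ ρ) (φ : ℝ) :
    ρ * |Real.sin φ| ≤ ‖1 + ρ * Complex.exp (φ * Complex.I)‖ := by
  refine le_trans (le_of_eq ?_) (Complex.abs_im_le_norm _)
  rw [Complex.add_im, Complex.im_ofReal_mul, Complex.exp_ofReal_mul_I_im]
  simp [abs_mul, abs_of_nonneg hρ]

lemma one_add_mul_exp_mem_slitPlane {ρ φ : ℝ} (hρ : 0 ≤ ρ) (hφ : |φ| < Real.pi) :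
    1 + ρ * Complex.exp (φ * Complex.I) ∈ Complex.slitPlane := by
  rw [abs_lt] at hφ
  by_cases h0 : Real.sin φ = 0 ∨ ρ = 0
  · left
    rw [Complex.add_re, Complex.re_ofReal_mul, Complex.exp_ofReal_mul_I_re]
    rcases h0 with h0 | h0
    · rw [(Real.sin_eq_zero_iff_of_lt_of_lt hφ.1 hφ.2).1 h0]
      simp
      positivity
    · simp [h0]
  · right
    rw [Complex.add_im, Complex.im_ofReal_mul, Complex.exp_ofReal_mul_I_im]
    push Not at h0
    simp [h0.1, h0.2]

/-! ### The jump across the cut: expansion, decay, sign -/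

/-- The jump, divided by `2 i`, of `(1 + z ^ b) ^ (-ν)` across the negative real axis at `-y`. -/
noncomputable def linnikJump (b ν y : ℝ) : ℝ :=
  ((1 + ((y ^ b : ℝ) : ℂ) * Complex.exp (((-(Real.pi * b) : ℝ) : ℂ) * Complex.I)) ^ (-(ν : ℂ))).im

section Jump

variable {b ν : ℝ}

lemma sin_pi_mul_pos (hb : 0 < b) (hb1 : b < 1) : 0 < Real.sin (Real.pi * b) :=
  Real.sin_pos_of_pos_of_lt_pi (by positivity) (by nlinarith [Real.pi_pos])

lemma abs_neg_pi_mul_lt (hb : 0 < b) (hb1 : b < 1) : |-(Real.pi * b)| < Real.pi := by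
  rw [abs_neg, abs_of_pos (by positivity)]
  nlinarith [Real.pi_pos]

lemma abs_sin_neg_pi_mul (hb : 0 < b) (hb1 : b < 1) :
    |Real.sin (-(Real.pi * b))| = Real.sin (Real.pi * b) := by
  rw [Real.sin_neg, abs_neg, abs_of_pos (sin_pi_mul_pos hb hb1)]

lemma measurable_linnikJump (b ν : ℝ) : Measurable (linnikJump b ν) := by
  unfold linnikJump
  fun_prop

/-- The imaginary part of the binomial remainder at `z = y ^ b * exp (-iπb)`, `t = 1`. The term `j =
0` is real, which is why the sum starts at `1`. -/
lemma abs_linnikJump_sub_le (hb : 0 < b) (hb1 : b < 1) (hν : 0 < ν) {N : ℕ} (hN : 1 ≤ N) {y : ℝ}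
    (hy : 0 ≤ y) :
    |linnikJump b ν y - ∑ j ∈ Finset.Ico 1 N,
        (-1) ^ (j - 1) * negBinomCoeff ν j * Real.sin (Real.pi * b * j) * y ^ (b * j)| ≤
      negBinomCoeff ν N / Real.sin (Real.pi * b) ^ (ν + N) * y ^ (b * N) := by
  have hρ : 0 ≤ y ^ b := Real.rpow_nonneg hy b
  set z : ℂ := ((y ^ b : ℝ) : ℂ) * Complex.exp (((-(Real.pi * b) : ℝ) : ℂ) * Complex.I) with hz
  have hzt : ∀ t : ℝ, 1 + t * z =
      1 + ((t * y ^ b : ℝ) : ℂ) * Complex.exp (((-(Real.pi * b) : ℝ) : ℂ) * Complex.I) := by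
    intro t
    rw [hz]
    push_cast
    ring
  have hmem : ∀ t : ℝ, 0 ≤ t → 1 + t * z ∈ Complex.slitPlane := fun t ht => by
    rw [hzt]
    exact one_add_mul_exp_mem_slitPlane (by positivity) (abs_neg_pi_mul_lt hb hb1)
  have hle : ∀ t : ℝ, 0 ≤ t → Real.sin (Real.pi * b) ≤ ‖1 + t * z‖ := fun t _ => by
    rw [hzt, ← abs_sin_neg_pi_mul hb hb1]
    exact abs_sin_le_norm_one_add _ _
  have hnorm : ‖z‖ = y ^ b := by
    rw [hz, norm_mul, Complex.norm_exp_ofReal_mul_I, mul_one, Complex.norm_real,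
      Real.norm_of_nonneg hρ]
  have h := norm_negBinomRemainder_le N hν (sin_pi_mul_pos hb hb1) hmem hle zero_le_one
  refine le_trans (le_of_eq ?_) ((Complex.abs_im_le_norm _).trans (h.trans_eq ?_))
  · congr 1
    rw [negBinomRemainder, Complex.ofReal_one, one_mul, Complex.sub_im, Complex.im_sum,
      Finset.range_eq_Ico, Finset.sum_eq_sum_Ico_succ_bot hN]
    simp only [linnikJump, ← hz]
    congr 1
    simp only [pow_zero, one_mul, mul_one, Complex.ofReal_im, zero_add]
    refine Finset.sum_congr rfl fun j hj => ?_
    have hj1 : 1 ≤ j := (Finset.mem_Ico.1 hj).1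
    have hzj : z ^ j = ((y ^ (b * j) : ℝ) : ℂ) *
        Complex.exp (((-(Real.pi * b * j) : ℝ) : ℂ) * Complex.I) := by
      rw [hz, mul_pow, ← Complex.exp_nat_mul, Real.rpow_mul hy, Real.rpow_natCast]
      push_cast
      congr 2
      ring
    have hc : (-1 : ℂ) ^ j * (negBinomCoeff ν j : ℂ) = (((-1) ^ j * negBinomCoeff ν j : ℝ) : ℂ) := by
      push_cast
      ring
    rw [hc, hzj, Complex.im_ofReal_mul, Complex.im_ofReal_mul, Complex.exp_ofReal_mul_I_im,
      Real.sin_neg]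
    -- The minus sign of `sin (-πbj)` turns `(-1) ^ j` into `(-1) ^ (j - 1)`; the natural
    -- subtraction is harmless as `j ≥ 1`.
    obtain ⟨k, rfl⟩ := Nat.exists_eq_add_of_le' hj1
    rw [Nat.add_sub_cancel, pow_succ]
    ring
  · rw [one_mul, hnorm, Real.rpow_mul hy, Real.rpow_natCast]
    ring

lemma abs_linnikJump_le (hb : 0 < b) (hb1 : b < 1) (hν : 0 < ν) (y : ℝ) :
    |linnikJump b ν y| ≤ Real.sin (Real.pi * b) ^ (-ν) := by
  refine (Complex.abs_im_le_norm _).trans ?_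
  rw [← Complex.ofReal_neg ν, Complex.norm_cpow_real]
  refine Real.rpow_le_rpow_of_nonpos (sin_pi_mul_pos hb hb1) ?_ (by linarith)
  rw [← abs_sin_neg_pi_mul hb hb1]
  exact abs_sin_le_norm_one_add _ _

lemma abs_linnikJump_le_rpow (hb : 0 < b) (hb1 : b < 1) (hν : 0 < ν) {y : ℝ} (hy : 0 < y) :
    |linnikJump b ν y| ≤ Real.sin (Real.pi * b) ^ (-ν) * y ^ (-(b * ν)) := by
  have hs := sin_pi_mul_pos hb hb1
  refine (Complex.abs_im_le_norm _).trans ?_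
  rw [← Complex.ofReal_neg ν, Complex.norm_cpow_real, show -(b * ν) = b * -ν by ring, Real.rpow_mul hy.le,
    ← Real.mul_rpow hs.le (by positivity)]
  refine Real.rpow_le_rpow_of_nonpos (by positivity) ?_ (by linarith)
  rw [mul_comm, ← abs_sin_neg_pi_mul hb hb1]
  exact mul_abs_sin_le_norm_one_add (by positivity) _

/-- The base lies in the lower half-plane, so its power `-ν` has argument in `(0, π)` when `ν ≤ 1`.
-/
lemma linnikJump_nonneg (hb : 0 < b) (hb1 : b < 1) (hν : 0 < ν) (hν1 : ν ≤ 1) {y : ℝ}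
    (hy : 0 < y) : 0 ≤ linnikJump b ν y := by
  have hs := sin_pi_mul_pos hb hb1
  have hρ : 0 < y ^ b := Real.rpow_pos_of_pos hy b
  unfold linnikJump
  set w : ℂ := 1 + ((y ^ b : ℝ) : ℂ) * Complex.exp (((-(Real.pi * b) : ℝ) : ℂ) * Complex.I)
    with hw
  have him : w.im < 0 := by
    rw [hw, Complex.add_im, Complex.im_ofReal_mul, Complex.exp_ofReal_mul_I_im, Real.sin_neg]
    simp only [Complex.one_im, zero_add]
    nlinarith
  have hw0 : w ≠ 0 := fun h => by simp [h] at him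
  have harg : w.arg < 0 := Complex.arg_neg_iff.2 him
  have harg' := Complex.neg_pi_lt_arg w
  rw [Complex.cpow_def_of_ne_zero hw0, Complex.exp_im]
  refine mul_nonneg (Real.exp_pos _).le ?_
  have : (Complex.log w * -(ν : ℂ)).im = -w.arg * ν := by
    simp [Complex.mul_im, Complex.log_im]
  rw [this]
  exact Real.sin_nonneg_of_nonneg_of_le_pi (by nlinarith) (by nlinarith)

/-- The integrand is `O(y ^ (b - 1))` near `0`, by the expansion with `N = 1`, and `O(y ^ (-bν -
1))` at infinity. -/
lemma integrableOn_linnikJump_div (hb : 0 < b) (hb1 : b < 1) (hν : 0 < ν) :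
    IntegrableOn (fun y => linnikJump b ν y / y) (Ioi 0) := by
  have hm : Measurable fun y => linnikJump b ν y / y := (measurable_linnikJump b ν).div measurable_id
  rw [← Ioc_union_Ioi_eq_Ioi zero_le_one]
  refine IntegrableOn.union ?_ ?_
  · have h : IntegrableOn (fun y : ℝ => negBinomCoeff ν 1 / Real.sin (Real.pi * b) ^ (ν + 1) *
        y ^ (b - 1)) (Ioc 0 1) := by
      refine Integrable.const_mul ?_ _
      rw [← IntegrableOn, ← intervalIntegrable_iff_integrableOn_Ioc_of_le zero_le_one]
      exact intervalIntegral.intervalIntegrable_rpow' (by linarith)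
    refine h.mono' hm.aestronglyMeasurable ?_
    filter_upwards [ae_restrict_mem measurableSet_Ioc] with y hy
    have := abs_linnikJump_sub_le hb hb1 hν le_rfl hy.1.le
    simp only [Finset.Ico_self, Finset.sum_empty, sub_zero, Nat.cast_one, mul_one] at this
    rw [norm_div, Real.norm_of_nonneg hy.1.le, Real.rpow_sub_one hy.1.ne', Real.norm_eq_abs,
      ← mul_div_assoc]
    have := hy.1
    gcongr
  · have h : IntegrableOn (fun y : ℝ => Real.sin (Real.pi * b) ^ (-ν) * y ^ (-(b * ν) - 1))
        (Ioi 1) :=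
      Integrable.const_mul (integrableOn_Ioi_rpow_of_lt (by nlinarith [mul_pos hb hν]) one_pos) _
    refine h.mono' hm.aestronglyMeasurable ?_
    filter_upwards [ae_restrict_mem measurableSet_Ioi] with y hy
    have hy0 : 0 < y := one_pos.trans hy
    have := abs_linnikJump_le_rpow hb hb1 hν hy0
    rw [norm_div, Real.norm_of_nonneg hy0.le, Real.rpow_sub_one hy0.ne', Real.norm_eq_abs,
      ← mul_div_assoc]
    gcongr

lemma integrableOn_linnikJump_div_add (hb : 0 < b) (hb1 : b < 1) (hν : 0 < ν) {c : ℝ}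
    (hc : 0 ≤ c) : IntegrableOn (fun y => linnikJump b ν y / (y + c)) (Ioi 0) := by
  refine Integrable.mono (integrableOn_linnikJump_div hb hb1 hν)
    ((measurable_linnikJump b ν).div (measurable_id.add_const c)).aestronglyMeasurable ?_
  filter_upwards [ae_restrict_mem measurableSet_Ioi] with y (hy : 0 < y)
  rw [norm_div, norm_div, Real.norm_of_nonneg hy.le, Real.norm_of_nonneg (by positivity : 0 ≤ y + c)]
  gcongr
  linarith

end Jump

/-! ### Stieltjes representation by Cauchy's theorem in a strip -/

/-- The function `(1 + z ^ b) ^ (-ν)` in the logarithmic variable `w`, where `z = exp w`. -/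
noncomputable def linnikLog (b ν : ℝ) (w : ℂ) : ℂ :=
  (1 + Complex.exp (b * w)) ^ (-(ν : ℂ))

section Stieltjes

variable {b ν : ℝ}

lemma measurable_linnikLog (b ν : ℝ) : Measurable (linnikLog b ν) := by
  unfold linnikLog
  fun_prop

/-- In the logarithmic variable the two sides of the cut are the lines `Im w = ±π`. For `b < 1` they
lie inside this strip, so no boundary limits are needed. -/
lemma differentiableOn_linnikLog (hb : 0 < b) (ν : ℝ) :
    DifferentiableOn ℂ (linnikLog b ν) {w | |w.im| < Real.pi / b} := by
  refine DifferentiableOn.cpow_const (by fun_prop) fun w (hw : |w.im| < Real.pi / b) => ?_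
  have h : (1 : ℂ) + Complex.exp (b * w) =
      1 + ((Real.exp (b * w.re) : ℝ) : ℂ) * Complex.exp (((b * w.im : ℝ) : ℂ) * Complex.I) := by
    push_cast
    rw [← Complex.exp_add]
    congr 2
    conv_lhs => rw [← Complex.re_add_im w]
    ring
  rw [h]
  refine one_add_mul_exp_mem_slitPlane (Real.exp_pos _).le ?_
  rwa [abs_mul, abs_of_pos hb, mul_comm, ← lt_div_iff₀ hb]

lemma linnikLog_log {c : ℝ} (b ν : ℝ) (hc : 0 < c) :
    linnikLog b ν (Real.log c : ℝ) = (((1 + c ^ b) ^ (-ν) : ℝ) : ℂ) := by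
  rw [linnikLog, Complex.ofReal_cpow (by positivity), Real.rpow_def_of_pos hc]
  push_cast
  rw [mul_comm]

/-- The values on the two edges are complex conjugates, so their difference is `2i` times an
imaginary part. -/
lemma linnikLog_sub_linnikLog (hb : 0 < b) (hb1 : b < 1) (ν x : ℝ) :
    linnikLog b ν (x + (-Real.pi : ℝ) * Complex.I) - linnikLog b ν (x + (Real.pi : ℝ) * Complex.I) =
      2 * Complex.I * linnikJump b ν (Real.exp x) := by
  have hz : (1 : ℂ) + Complex.exp (b * (x + (-Real.pi : ℝ) * Complex.I)) =
      1 + ((Real.exp x ^ b : ℝ) : ℂ) *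
        Complex.exp (((-(Real.pi * b) : ℝ) : ℂ) * Complex.I) := by
    rw [← Real.exp_mul]
    push_cast
    rw [← Complex.exp_add]
    congr 2
    ring
  have hconj : linnikLog b ν (x + (Real.pi : ℝ) * Complex.I) =
      (starRingEnd ℂ) (linnikLog b ν (x + (-Real.pi : ℝ) * Complex.I)) := by
    have harg : ((1 : ℂ) + Complex.exp (b * (x + (-Real.pi : ℝ) * Complex.I))).arg ≠ Real.pi := by
      rw [hz]
      exact Complex.slitPlane_arg_ne_pi
        (one_add_mul_exp_mem_slitPlane (by positivity) (abs_neg_pi_mul_lt hb hb1))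
    have h := Complex.conj_cpow _ (-(ν : ℂ)) harg
    rw [map_neg, Complex.conj_ofReal] at h
    rw [linnikLog, linnikLog, ← h, map_add, map_one, ← Complex.exp_conj]
    simp
  rw [hconj, Complex.sub_conj, linnikLog, hz, linnikJump]
  push_cast
  ring

lemma tendsto_re_ofReal_mul_atTop (hb : 0 < b) :
    Tendsto (fun w : ℂ => (b : ℂ) * w) (comap Complex.re atTop) (comap Complex.re atTop) := by
  rw [tendsto_comap_iff]
  simpa [Function.comp_def] using tendsto_comap.const_mul_atTop hb

lemma tendsto_re_ofReal_mul_atBot (hb : 0 < b) :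
    Tendsto (fun w : ℂ => (b : ℂ) * w) (comap Complex.re atBot) (comap Complex.re atBot) := by
  rw [tendsto_comap_iff]
  simpa [Function.comp_def] using tendsto_comap.const_mul_atBot hb

lemma tendsto_linnikLog_atTop (hb : 0 < b) (hν : 0 < ν) :
    Tendsto (linnikLog b ν) (comap Complex.re atTop) (𝓝 0) := by
  rw [tendsto_zero_iff_norm_tendsto_zero]
  have h : Tendsto (fun w : ℂ => ‖1 + Complex.exp (b * w)‖) (comap Complex.re atTop) atTop :=
    tendsto_norm_cobounded_atTop.comp ((tendsto_const_add_cobounded 1).comp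
      (Complex.tendsto_exp_comap_re_atTop.comp (tendsto_re_ofReal_mul_atTop hb)))
  refine ((tendsto_rpow_neg_atTop hν).comp h).congr fun w => ?_
  rw [linnikLog, ← Complex.ofReal_neg, Complex.norm_cpow_real, Function.comp_apply]

lemma tendsto_linnikLog_atBot (hb : 0 < b) (ν : ℝ) :
    Tendsto (linnikLog b ν) (comap Complex.re atBot) (𝓝 1) := by
  have h : Tendsto (fun w : ℂ => 1 + Complex.exp (b * w)) (comap Complex.re atBot) (𝓝 (1 + 0)) :=
    (Complex.tendsto_exp_comap_re_atBot.comp (tendsto_re_ofReal_mul_atBot hb)).const_add 1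
  have hc : ContinuousAt (fun z : ℂ => z ^ (-(ν : ℂ))) (1 + 0) :=
    (Complex.hasStrictDerivAt_cpow_const (by simp)).hasDerivAt.continuousAt
  have := hc.tendsto.comp h
  simp only [add_zero, Complex.one_cpow] at this
  exact this

lemma tendsto_exp_div_exp_sub_atTop (c : ℂ) :
    Tendsto (fun w => Complex.exp w / (Complex.exp w - c)) (comap Complex.re atTop) (𝓝 1) := by
  have h : Tendsto (fun w => (1 - c * (Complex.exp w)⁻¹)⁻¹) (comap Complex.re atTop)
      (𝓝 (1 - c * 0)⁻¹) :=
    (((tendsto_inv₀_cobounded.comp Complex.tendsto_exp_comap_re_atTop).const_mul c).const_sub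
      1).inv₀ (by simp)
  rw [mul_zero, sub_zero, inv_one] at h
  refine h.congr fun w => ?_
  have := Complex.exp_ne_zero w
  rw [← div_eq_mul_inv, one_sub_div this, inv_div]

lemma tendsto_exp_div_exp_sub_atBot {c : ℂ} (hc : c ≠ 0) :
    Tendsto (fun w => Complex.exp w / (Complex.exp w - c)) (comap Complex.re atBot) (𝓝 0) := by
  have h := Complex.tendsto_exp_comap_re_atBot.div
    (Complex.tendsto_exp_comap_re_atBot.sub_const c) (by simpa using hc)
  rw [zero_div] at h
  exact h

/-- Convergence along `comap re` is uniform in the imaginary part, so a constant dominates. -/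
lemma tendsto_integral_vertical {H : ℂ → ℂ} (hH : Measurable H) {l : Filter ℝ}
    [l.IsCountablyGenerated] {m : ℂ} (h : Tendsto H (comap Complex.re l) (𝓝 m)) :
    Tendsto (fun R : ℝ => ∫ y in (-Real.pi)..Real.pi, H (R + y * Complex.I)) l
      (𝓝 (2 * Real.pi * m)) := by
  have hbd : ∀ᶠ R in l, ∀ w : ℂ, w.re = R → ‖H w‖ ≤ ‖m‖ + 1 :=
    eventually_comap.1 (h.norm.eventually (eventually_le_nhds (lt_add_one ‖m‖)))
  have hlim : (2 * Real.pi * m : ℂ) = ∫ _ in (-Real.pi)..Real.pi, m := by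
    rw [intervalIntegral.integral_const, Complex.real_smul]
    push_cast
    ring
  rw [hlim]
  refine intervalIntegral.tendsto_integral_filter_of_dominated_convergence (fun _ => ‖m‖ + 1)
    (Eventually.of_forall fun R => (hH.comp (by fun_prop)).aestronglyMeasurable) ?_
    intervalIntegrable_const (Eventually.of_forall fun y _ => ?_)
  · filter_upwards [hbd] with R hR
    exact Eventually.of_forall fun y _ => hR _ (by simp)
  · refine h.comp ?_
    rw [tendsto_comap_iff]
    exact tendsto_id.congr fun R => by simp

lemma exp_eq_ofReal_iff {c : ℝ} (hc : 0 < c) {w : ℂ} (hw : |w.im| ≤ Real.pi) :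
    Complex.exp w = c ↔ w = (Real.log c : ℝ) := by
  refine ⟨fun h => ?_, fun h => by rw [h, ← Complex.ofReal_exp, Real.exp_log hc]⟩
  rw [← Real.exp_log hc, Complex.ofReal_exp, Complex.exp_eq_exp_iff_exists_int] at h
  obtain ⟨k, hk⟩ := h
  have him : w.im = k * (2 * Real.pi) := by
    rw [hk]
    simp
  have hk0 : k = 0 := by
    rw [him, abs_mul, abs_of_pos (by positivity : 0 < 2 * Real.pi)] at hw
    have : |(k : ℝ)| < 1 := by nlinarith [Real.pi_pos]
    exact Int.abs_lt_one_iff.1 (by exact_mod_cast this)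
  rw [hk, hk0]
  simp

/-- The integrand of the Cauchy integral, with the pole at `log c` removed. -/
noncomputable def linnikKernel (b ν c : ℝ) (w : ℂ) : ℂ :=
  dslope (linnikLog b ν) (Real.log c : ℝ) w * Complex.exp w /
    dslope Complex.exp (Real.log c : ℝ) w

lemma linnikKernel_eq {c : ℝ} (hc : 0 < c) (b ν : ℝ) {w : ℂ} (hw : |w.im| ≤ Real.pi)
    (hwc : w ≠ (Real.log c : ℝ)) :
    linnikKernel b ν c w = (linnikLog b ν w - ((1 + c ^ b) ^ (-ν) : ℝ)) *
      (Complex.exp w / (Complex.exp w - c)) := by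
  have h1 : Complex.exp w - c ≠ 0 := sub_ne_zero.2 fun h => hwc ((exp_eq_ofReal_iff hc hw).1 h)
  have h2 : w - (Real.log c : ℝ) ≠ 0 := sub_ne_zero.2 hwc
  rw [linnikKernel, dslope_of_ne _ hwc, dslope_of_ne _ hwc, slope_def_field, slope_def_field,
    linnikLog_log b ν hc, ← Complex.ofReal_exp, Real.exp_log hc]
  field_simp

/-- Both slopes extend holomorphically over `log c`. The denominator does not vanish: its value
there is `c`, and elsewhere in the closed strip `exp w ≠ c`. -/
lemma differentiableOn_linnikKernel {c : ℝ} (hc : 0 < c) (hb : 0 < b) (hb1 : b < 1) (ν : ℝ) :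
    DifferentiableOn ℂ (linnikKernel b ν c) {w | |w.im| ≤ Real.pi} := by
  have hsub : {w : ℂ | |w.im| ≤ Real.pi} ⊆ {w | |w.im| < Real.pi / b} := fun w hw =>
    lt_of_le_of_lt hw (by rw [lt_div_iff₀ hb]; exact mul_lt_of_lt_one_right Real.pi_pos hb1)
  have hopen : IsOpen {w : ℂ | |w.im| < Real.pi / b} :=
    isOpen_lt (by fun_prop) continuous_const
  have hmem : {w : ℂ | |w.im| < Real.pi / b} ∈ 𝓝 ((Real.log c : ℝ) : ℂ) :=
    hopen.mem_nhds (by simp; positivity)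
  have h1 := ((Complex.differentiableOn_dslope hmem).2 (differentiableOn_linnikLog hb ν)).mono hsub
  have h2 : DifferentiableOn ℂ (dslope Complex.exp ((Real.log c : ℝ) : ℂ))
      {w : ℂ | |w.im| ≤ Real.pi} :=
    ((Complex.differentiableOn_dslope univ_mem).2
      Complex.differentiable_exp.differentiableOn).mono (subset_univ _)
  refine (h1.mul Complex.differentiable_exp.differentiableOn).div h2 fun w hw => ?_
  by_cases hwc : w = (Real.log c : ℝ)
  · rw [hwc, dslope_same, Complex.deriv_exp]
    exact Complex.exp_ne_zero _
  · rw [dslope_of_ne _ hwc, slope_def_field]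
    refine div_ne_zero (sub_ne_zero.2 fun h => hwc ?_) (sub_ne_zero.2 hwc)
    rwa [← Complex.ofReal_exp, Real.exp_log hc, exp_eq_ofReal_iff hc hw] at h

/-- On both edges `exp w = -exp x`, so the rational factor is common and the subtracted constant
cancels. -/
lemma linnikKernel_sub_linnikKernel {c : ℝ} (hc : 0 < c) (hb : 0 < b) (hb1 : b < 1) (ν x : ℝ) :
    linnikKernel b ν c (x + (-Real.pi : ℝ) * Complex.I) -
        linnikKernel b ν c (x + (Real.pi : ℝ) * Complex.I) =
      2 * Complex.I *
        ((Real.exp x * (linnikJump b ν (Real.exp x) / (Real.exp x + c)) : ℝ) : ℂ) := by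
  have hpi := Real.pi_pos
  have hne : ∀ s : ℝ, s ≠ 0 → (x + (s : ℂ) * Complex.I) ≠ ((Real.log c : ℝ) : ℂ) := by
    intro s hs h
    have := congrArg Complex.im h
    simp at this
    exact hs this
  have h1 : Complex.exp (x + (Real.pi : ℝ) * Complex.I) = -Real.exp x := by
    rw [Complex.exp_add, Complex.exp_pi_mul_I]
    simp
  have h2 : Complex.exp (x + (-Real.pi : ℝ) * Complex.I) = -Real.exp x := by
    rw [Complex.exp_add, Complex.ofReal_neg, neg_mul, Complex.exp_neg, Complex.exp_pi_mul_I]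
    norm_num
  have h3 : ((Real.exp x : ℝ) : ℂ) + c ≠ 0 := by
    have : Real.exp x + c ≠ 0 := by positivity
    exact_mod_cast this
  rw [linnikKernel_eq hc b ν (by simp [abs_of_pos hpi]) (hne _ (by linarith)),
    linnikKernel_eq hc b ν (by simp [abs_of_pos hpi]) (hne _ hpi.ne'), h1, h2, ← sub_mul,
    sub_sub_sub_cancel_right, linnikLog_sub_linnikLog hb hb1, ← neg_add', neg_div_neg_eq]
  push_cast at h3 ⊢
  field_simp

lemma integrable_exp_mul_linnikJump {c : ℝ} (hc : 0 < c) (hb : 0 < b) (hb1 : b < 1) (hν : 0 < ν) :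
    Integrable (fun x : ℝ => Real.exp x * (linnikJump b ν (Real.exp x) / (Real.exp x + c))) ∧
    ∫ x : ℝ, Real.exp x * (linnikJump b ν (Real.exp x) / (Real.exp x + c)) =
      ∫ y in Ioi 0, linnikJump b ν y / (y + c) := by
  have him : Real.exp '' univ = Ioi 0 := by rw [image_univ, Real.range_exp]
  have hd : ∀ x ∈ (univ : Set ℝ), HasDerivWithinAt Real.exp (Real.exp x) univ x := fun x _ =>
    (Real.hasDerivAt_exp x).hasDerivWithinAt
  have hinj : InjOn Real.exp univ := Real.exp_injective.injOn
  have h1 := integrableOn_image_iff_integrableOn_abs_deriv_smul MeasurableSet.univ hd hinj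
    fun y => linnikJump b ν y / (y + c)
  have h2 := integral_image_eq_integral_abs_deriv_smul MeasurableSet.univ hd hinj
    fun y => linnikJump b ν y / (y + c)
  rw [him] at h1 h2
  simp only [abs_of_pos (Real.exp_pos _), smul_eq_mul, integrableOn_univ,
    Measure.restrict_univ] at h1 h2
  exact ⟨h1.1 (integrableOn_linnikJump_div_add hb hb1 hν hc.le), h2.symm⟩

/-- The Stieltjes representation of `(1 + c ^ b) ^ (-ν)`. -/
lemma integral_linnikJump_div_add {c : ℝ} (hc : 0 < c) (hb : 0 < b) (hb1 : b < 1) (hν : 0 < ν) :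
    ∫ y in Ioi 0, linnikJump b ν y / (y + c) = Real.pi * (1 + c ^ b) ^ (-ν) := by
  have hpi := Real.pi_pos
  obtain ⟨hint, heq⟩ := integrable_exp_mul_linnikJump hc hb hb1 hν
  set f : ℝ → ℝ := fun x => Real.exp x * (linnikJump b ν (Real.exp x) / (Real.exp x + c)) with hf
  set F : ℂ := (((1 + c ^ b) ^ (-ν) : ℝ) : ℂ) with hF
  set H : ℂ → ℂ := fun w => (linnikLog b ν w - F) * (Complex.exp w / (Complex.exp w - c)) with hH
  have hHm : Measurable H := by
    have := measurable_linnikLog b ν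
    fun_prop
  have hdiff := differentiableOn_linnikKernel hc hb hb1 ν
  -- Subtracting `F` removes the pole, so the value to be computed reappears as the limit `-F` at
  -- the right end; the left end contributes nothing.
  have htop : Tendsto H (comap Complex.re atTop) (𝓝 (-F)) := by
    simpa using ((tendsto_linnikLog_atTop hb hν).sub_const F).mul (tendsto_exp_div_exp_sub_atTop c)
  have hbot : Tendsto H (comap Complex.re atBot) (𝓝 0) := by
    simpa using ((tendsto_linnikLog_atBot hb ν).sub_const F).mul
      (tendsto_exp_div_exp_sub_atBot (c := c) (by exact_mod_cast hc.ne'))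
  have h1 := tendsto_integral_vertical hHm htop
  have h2 := (tendsto_integral_vertical hHm hbot).comp tendsto_neg_atTop_atBot
  have h3 := intervalIntegral_tendsto_integral hint tendsto_neg_atTop_atBot tendsto_id
  have h3' := ((Complex.continuous_ofReal.tendsto _).comp h3).const_mul (2 * Complex.I)
  have hsum := (h3'.add (h1.const_mul Complex.I)).sub (h2.const_mul Complex.I)
  have hzero : ∀ᶠ R : ℝ in atTop,
      2 * Complex.I * ((∫ x in (-R)..R, f x : ℝ) : ℂ) +
        Complex.I * (∫ y in (-Real.pi)..Real.pi, H (R + y * Complex.I)) -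
        Complex.I * (∫ y in (-Real.pi)..Real.pi, H ((-R : ℝ) + y * Complex.I)) = 0 := by
    -- Beyond `|log c|` the vertical sides avoid the point `log c`, the only one in the closed strip
    -- where `H` and the kernel may differ.
    filter_upwards [eventually_gt_atTop |Real.log c|] with R hR
    have hR0 : 0 < R := (abs_nonneg _).trans_lt hR
    have hstrip : (uIcc (((-R : ℝ) : ℂ) + (-Real.pi : ℝ) * Complex.I).re
          ((R : ℂ) + Real.pi * Complex.I).re ×ℂ
        uIcc (((-R : ℝ) : ℂ) + (-Real.pi : ℝ) * Complex.I).im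
          ((R : ℂ) + Real.pi * Complex.I).im) ⊆ {w : ℂ | |w.im| ≤ Real.pi} := by
      rintro w ⟨-, hw⟩
      simp only [mem_preimage, Complex.add_im, Complex.ofReal_im, Complex.im_ofReal_mul,
        Complex.I_im, mul_one, zero_add, uIcc_of_le (by linarith : -Real.pi ≤ Real.pi)] at hw
      exact abs_le.2 hw
    have hC := Complex.integral_boundary_rect_eq_zero_of_differentiableOn _ _ _ (hdiff.mono hstrip)
    simp only [Complex.add_im, Complex.add_re, Complex.ofReal_im, Complex.ofReal_re,
      Complex.im_ofReal_mul, Complex.re_ofReal_mul, Complex.I_im, Complex.I_re, mul_one,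
      mul_zero, zero_add, add_zero, smul_eq_mul] at hC
    have hcont : ∀ s : ℝ, |s| ≤ Real.pi → Continuous fun x : ℝ =>
        linnikKernel b ν c (x + (s : ℂ) * Complex.I) := fun s hs =>
      hdiff.continuousOn.comp_continuous (by fun_prop) fun x => by simpa using hs
    rw [← intervalIntegral.integral_sub
      ((hcont _ (by simp [abs_of_pos hpi])).intervalIntegrable _ _)
      ((hcont _ (by simp [abs_of_pos hpi])).intervalIntegrable _ _)] at hC
    simp only [linnikKernel_sub_linnikKernel hc hb hb1, intervalIntegral.integral_const_mul] at hC
    rw [intervalIntegral.integral_ofReal] at hC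
    have hvert : ∀ s : ℝ, |Real.log c| < |s| →
        ∫ y in (-Real.pi)..Real.pi, linnikKernel b ν c (s + y * Complex.I) =
          ∫ y in (-Real.pi)..Real.pi, H (s + y * Complex.I) := by
      intro s hs
      refine intervalIntegral.integral_congr fun y hy => ?_
      rw [uIcc_of_le (by linarith)] at hy
      refine linnikKernel_eq hc b ν (by simpa using abs_le.2 hy) fun h => ?_
      have := congrArg Complex.re h
      simp at this
      rw [this] at hs
      exact lt_irrefl _ hs
    rw [hvert R (by rwa [abs_of_pos hR0]),
      hvert (-R) (by rwa [abs_neg, abs_of_pos hR0])] at hC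
    exact hC
  have hlim := tendsto_nhds_unique hsum
    ((tendsto_congr' (f₂ := fun _ => (0 : ℂ)) hzero).2 tendsto_const_nhds)
  rw [heq] at hlim
  have hfin : (((∫ y in Ioi 0, linnikJump b ν y / (y + c) : ℝ)) : ℂ) =
      ((Real.pi * (1 + c ^ b) ^ (-ν) : ℝ) : ℂ) := by
    have hI : (2 * Complex.I) ≠ 0 := by simp
    apply mul_left_cancel₀ hI
    rw [Complex.ofReal_mul, ← hF]
    linear_combination hlim
  exact_mod_cast hfin

end Stieltjes

/-! ### The mixing density: Laplace transform and expansion -/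

/-- The density of the mixing distribution, with Laplace transform `c ↦ (1 + c ^ b) ^ (-ν)`. -/
noncomputable def linnikMixing (b ν u : ℝ) : ℝ :=
  Real.pi⁻¹ * ∫ y in Ioi 0, Real.exp (-(u * y)) * linnikJump b ν y

lemma integrableOn_rpow_mul_exp_neg_mul {a r : ℝ} (ha : 0 < a) (hr : 0 < r) :
    IntegrableOn (fun t : ℝ => t ^ (a - 1) * Real.exp (-(r * t))) (Ioi 0) := by
  simpa using integrableOn_rpow_mul_exp_neg_mul_rpow (s := a - 1) (p := 1) (by linarith)
    one_pos hr

lemma integrableOn_exp_neg_mul {r : ℝ} (hr : 0 < r) :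
    IntegrableOn (fun t : ℝ => Real.exp (-(r * t))) (Ioi 0) := by
  simpa using integrableOn_rpow_mul_exp_neg_mul one_pos hr

lemma integral_exp_neg_mul {r : ℝ} (hr : 0 < r) :
    ∫ t in Ioi 0, Real.exp (-(r * t)) = r⁻¹ := by
  simpa using Real.integral_rpow_mul_exp_neg_mul_Ioi one_pos hr

lemma rpow_neg_sub_one_mul_exp_eq {a r x : ℝ} (hx : 0 < x) :
    (|(-1 : ℝ)| * x ^ ((-1 : ℝ) - 1)) • ((x ^ (-1 : ℝ)) ^ (a - 1) * Real.exp (-(r * x ^ (-1 : ℝ)))) =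
      x ^ (-a - 1) * Real.exp (-(r / x)) := by
  rw [← Real.rpow_mul hx.le, abs_neg, abs_one, one_mul, smul_eq_mul, ← mul_assoc,
    ← Real.rpow_add hx, Real.rpow_neg_one, div_eq_mul_inv]
  congr 2
  ring

lemma integrableOn_rpow_mul_exp_neg_div {a r : ℝ} (ha : 0 < a) (hr : 0 < r) :
    IntegrableOn (fun x : ℝ => x ^ (-a - 1) * Real.exp (-(r / x))) (Ioi 0) :=
  ((integrableOn_Ioi_comp_rpow_iff _ (by norm_num : (-1 : ℝ) ≠ 0)).2
    (integrableOn_rpow_mul_exp_neg_mul ha hr)).congr_fun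
      (fun _ hx => rpow_neg_sub_one_mul_exp_eq hx) measurableSet_Ioi

lemma integral_rpow_mul_exp_neg_div {a r : ℝ} (ha : 0 < a) (hr : 0 < r) :
    ∫ x in Ioi 0, x ^ (-a - 1) * Real.exp (-(r / x)) = r ^ (-a) * Real.Gamma a := by
  have h := integral_comp_rpow_Ioi (fun t : ℝ => t ^ (a - 1) * Real.exp (-(r * t)))
    (by norm_num : (-1 : ℝ) ≠ 0)
  rw [setIntegral_congr_fun measurableSet_Ioi fun x hx => rpow_neg_sub_one_mul_exp_eq hx,
    Real.integral_rpow_mul_exp_neg_mul_Ioi ha hr] at h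
  rw [h, one_div, Real.inv_rpow hr.le, Real.rpow_neg hr.le]

section Mixing

variable {b ν : ℝ}

/-- Integrating the norm in `u` first leaves `|J y| / y`. -/
lemma integrable_exp_mul_linnikJump_prod (hb : 0 < b) (hb1 : b < 1) (hν : 0 < ν) :
    Integrable (fun p : ℝ × ℝ => Real.exp (-(p.1 * p.2)) * linnikJump b ν p.2)
      ((volume.restrict (Ioi 0)).prod (volume.restrict (Ioi 0))) := by
  have hm := measurable_linnikJump b ν
  rw [integrable_prod_iff' (Measurable.aestronglyMeasurable (by fun_prop))]
  constructor
  · filter_upwards [ae_restrict_mem measurableSet_Ioi] with y (hy : 0 < y)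
    simpa only [mul_comm y] using (integrableOn_exp_neg_mul hy).mul_const (linnikJump b ν y)
  · refine (integrableOn_linnikJump_div hb hb1 hν).norm.congr ?_
    filter_upwards [ae_restrict_mem measurableSet_Ioi] with y (hy : 0 < y)
    have : ∀ u : ℝ, ‖Real.exp (-(u * y)) * linnikJump b ν y‖ =
        Real.exp (-(y * u)) * ‖linnikJump b ν y‖ := fun u => by
      rw [norm_mul, Real.norm_of_nonneg (Real.exp_pos _).le, mul_comm u]
    simp only [this]
    rw [integral_mul_const, integral_exp_neg_mul hy, norm_div, Real.norm_of_nonneg hy.le,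
      div_eq_inv_mul]

lemma integrableOn_linnikMixing (hb : 0 < b) (hb1 : b < 1) (hν : 0 < ν) :
    IntegrableOn (linnikMixing b ν) (Ioi 0) :=
  (integrable_exp_mul_linnikJump_prod hb hb1 hν).integral_prod_left.const_mul _

lemma integrableOn_exp_mul_linnikMixing (hb : 0 < b) (hb1 : b < 1) (hν : 0 < ν) {c : ℝ}
    (hc : 0 ≤ c) : IntegrableOn (fun u => Real.exp (-(c * u)) * linnikMixing b ν u) (Ioi 0) := by
  refine Integrable.mono (integrableOn_linnikMixing hb hb1 hν)
    ((Measurable.aestronglyMeasurable (by fun_prop)).mul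
      (integrableOn_linnikMixing hb hb1 hν).aestronglyMeasurable) ?_
  filter_upwards [ae_restrict_mem measurableSet_Ioi] with u (hu : 0 < u)
  rw [norm_mul, Real.norm_of_nonneg (Real.exp_pos _).le]
  exact mul_le_of_le_one_left (norm_nonneg _) (Real.exp_le_one_iff.2 (by nlinarith))

lemma integral_exp_mul_linnikMixing_of_pos (hb : 0 < b) (hb1 : b < 1) (hν : 0 < ν) {c : ℝ}
    (hc : 0 < c) :
    ∫ u in Ioi 0, Real.exp (-(c * u)) * linnikMixing b ν u = (1 + c ^ b) ^ (-ν) := by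
  have hm := measurable_linnikJump b ν
  have hint : Integrable
      (Function.uncurry fun u y => Real.exp (-(c * u)) * (Real.exp (-(u * y)) * linnikJump b ν y))
      ((volume.restrict (Ioi 0)).prod (volume.restrict (Ioi 0))) := by
    refine (integrable_exp_mul_linnikJump_prod hb hb1 hν).mono
      (Measurable.aestronglyMeasurable (by fun_prop)) ?_
    rw [Measure.prod_restrict]
    filter_upwards [ae_restrict_mem (measurableSet_Ioi.prod measurableSet_Ioi)] with p hp
    have hp1 : 0 < p.1 := hp.1
    simp only [Function.uncurry]
    rw [norm_mul, Real.norm_of_nonneg (Real.exp_pos _).le]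
    exact mul_le_of_le_one_left (norm_nonneg _) (Real.exp_le_one_iff.2 (by nlinarith))
  have h1 : ∀ u, Real.exp (-(c * u)) * linnikMixing b ν u =
      Real.pi⁻¹ * ∫ y in Ioi 0, Real.exp (-(c * u)) * (Real.exp (-(u * y)) * linnikJump b ν y) := by
    intro u
    rw [integral_const_mul, linnikMixing]
    ring
  simp only [h1]
  rw [integral_const_mul, integral_integral_swap hint]
  have h2 : ∀ y ∈ Ioi (0 : ℝ),
      ∫ u in Ioi 0, Real.exp (-(c * u)) * (Real.exp (-(u * y)) * linnikJump b ν y) =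
        linnikJump b ν y / (y + c) := by
    intro y (hy : 0 < y)
    rw [div_eq_inv_mul, ← integral_exp_neg_mul (by positivity : 0 < y + c), ← integral_mul_const]
    congr 1
    ext u
    rw [← mul_assoc, ← Real.exp_add]
    congr 2
    ring
  rw [setIntegral_congr_fun measurableSet_Ioi h2, integral_linnikJump_div_add hc hb hb1 hν,
    inv_mul_cancel_left₀ Real.pi_ne_zero]

/-- The contour argument needs `log c`; the value `c = 0`, which is the total mass, is reached by
dominated convergence. -/
lemma integral_exp_mul_linnikMixing (hb : 0 < b) (hb1 : b < 1) (hν : 0 < ν) {c : ℝ}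
    (hc : 0 ≤ c) :
    ∫ u in Ioi 0, Real.exp (-(c * u)) * linnikMixing b ν u = (1 + c ^ b) ^ (-ν) := by
  rcases hc.eq_or_lt with rfl | hc
  swap
  · exact integral_exp_mul_linnikMixing_of_pos hb hb1 hν hc
  have h1 : Tendsto (fun c : ℝ => ∫ u in Ioi 0, Real.exp (-(c * u)) * linnikMixing b ν u) (𝓝[>] 0)
      (𝓝 (∫ u in Ioi 0, Real.exp (-(0 * u)) * linnikMixing b ν u)) := by
    refine tendsto_integral_filter_of_dominated_convergence (fun u => ‖linnikMixing b ν u‖) ?_ ?_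
      (integrableOn_linnikMixing hb hb1 hν).norm (Eventually.of_forall fun u => ?_)
    · filter_upwards [self_mem_nhdsWithin] with c (hc : 0 < c)
      exact (integrableOn_exp_mul_linnikMixing hb hb1 hν hc.le).aestronglyMeasurable
    · filter_upwards [self_mem_nhdsWithin] with c (hc : 0 < c)
      filter_upwards [ae_restrict_mem measurableSet_Ioi] with u (hu : 0 < u)
      rw [norm_mul, Real.norm_of_nonneg (Real.exp_pos _).le]
      exact mul_le_of_le_one_left (norm_nonneg _) (Real.exp_le_one_iff.2 (by nlinarith))
    · exact ((by fun_prop : Continuous fun c : ℝ =>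
        Real.exp (-(c * u)) * linnikMixing b ν u).tendsto 0).mono_left nhdsWithin_le_nhds
  have h2 : Tendsto (fun c : ℝ => (1 + c ^ b) ^ (-ν)) (𝓝[>] 0) (𝓝 ((1 + 0 ^ b) ^ (-ν))) := by
    refine Tendsto.mono_left ?_ nhdsWithin_le_nhds
    refine Tendsto.rpow_const (((Real.continuousAt_rpow_const 0 b (Or.inr hb.le)).tendsto).const_add 1)
      (Or.inl ?_)
    rw [Real.zero_rpow hb.ne']
    norm_num
  refine tendsto_nhds_unique h1 (h2.congr' ?_)
  filter_upwards [self_mem_nhdsWithin] with c hc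
  exact (integral_exp_mul_linnikMixing_of_pos hb hb1 hν hc).symm

lemma linnikMixing_nonneg (hb : 0 < b) (hb1 : b < 1) (hν : 0 < ν) (hν1 : ν ≤ 1) (u : ℝ) :
    0 ≤ linnikMixing b ν u :=
  mul_nonneg (by positivity) (setIntegral_nonneg measurableSet_Ioi fun _ hy =>
    mul_nonneg (Real.exp_pos _).le (linnikJump_nonneg hb hb1 hν hν1 hy))

lemma integrableOn_exp_mul_rpow (hb : 0 < b) (j : ℕ) {u : ℝ} (hu : 0 < u) :
    IntegrableOn (fun y : ℝ => Real.exp (-(u * y)) * y ^ (b * j)) (Ioi 0) := by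
  simpa [mul_comm] using integrableOn_rpow_mul_exp_neg_mul (by positivity : 0 < b * j + 1) hu

lemma integral_exp_mul_rpow (hb : 0 < b) (j : ℕ) {u : ℝ} (hu : 0 < u) :
    ∫ y in Ioi 0, Real.exp (-(u * y)) * y ^ (b * j) =
      Real.Gamma (b * j + 1) * u ^ (-(b * j) - 1) := by
  have h := Real.integral_rpow_mul_exp_neg_mul_Ioi (by positivity : 0 < b * j + 1) hu
  rw [add_sub_cancel_right, one_div, Real.inv_rpow hu.le, ← Real.rpow_neg hu.le, neg_add'] at h
  rw [mul_comm (Real.Gamma _), ← h]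
  simp only [mul_comm]

/-- Watson's lemma with an explicit error: the bound on the jump holds for all `y ≥ 0`, so it can be
integrated against `exp (-u y)` without splitting the range. -/
lemma abs_linnikMixing_sub_le (hb : 0 < b) (hb1 : b < 1) (hν : 0 < ν) {N : ℕ} (hN : 1 ≤ N)
    {u : ℝ} (hu : 0 < u) :
    |linnikMixing b ν u - ∑ j ∈ Finset.Ico 1 N, Real.pi⁻¹ *
        ((-1) ^ (j - 1) * negBinomCoeff ν j * Real.sin (Real.pi * b * j)) *
          (Real.Gamma (b * j + 1) * u ^ (-(b * j) - 1))| ≤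
      Real.pi⁻¹ * (negBinomCoeff ν N / Real.sin (Real.pi * b) ^ (ν + N)) *
        (Real.Gamma (b * N + 1) * u ^ (-(b * N) - 1)) := by
  set a : ℕ → ℝ := fun j => (-1) ^ (j - 1) * negBinomCoeff ν j * Real.sin (Real.pi * b * j)
  have hjump : IntegrableOn (fun y => Real.exp (-(u * y)) * linnikJump b ν y) (Ioi 0) := by
    refine Integrable.mono' ((integrableOn_exp_neg_mul hu).mul_const (Real.sin (Real.pi * b) ^ (-ν)))
      (Measurable.aestronglyMeasurable
        (Measurable.mul (by fun_prop) (measurable_linnikJump b ν))) (Eventually.of_forall fun y => ?_)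
    rw [norm_mul, Real.norm_of_nonneg (Real.exp_pos _).le]
    exact mul_le_mul_of_nonneg_left (abs_linnikJump_le hb hb1 hν y) (Real.exp_pos _).le
  have hterm : ∀ j : ℕ, IntegrableOn (fun y : ℝ => a j * (Real.exp (-(u * y)) * y ^ (b * j)))
      (Ioi 0) := fun j => (integrableOn_exp_mul_rpow hb j hu).const_mul _
  have heq : linnikMixing b ν u - ∑ j ∈ Finset.Ico 1 N, Real.pi⁻¹ * a j *
      (Real.Gamma (b * j + 1) * u ^ (-(b * j) - 1)) =
      Real.pi⁻¹ * ∫ y in Ioi 0, (Real.exp (-(u * y)) * linnikJump b ν y -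
        ∑ j ∈ Finset.Ico 1 N, a j * (Real.exp (-(u * y)) * y ^ (b * j))) := by
    rw [integral_sub hjump (integrable_finsetSum _ fun j _ => hterm j),
      integral_finsetSum _ fun j _ => hterm j, mul_sub, Finset.mul_sum, linnikMixing]
    congr 1
    refine Finset.sum_congr rfl fun j _ => ?_
    rw [integral_const_mul, integral_exp_mul_rpow hb j hu, mul_assoc]
  rw [heq, abs_mul, abs_of_pos (by positivity), mul_assoc, ← integral_exp_mul_rpow hb N hu,
    ← integral_const_mul]
  refine mul_le_mul_of_nonneg_left ?_ (by positivity)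
  rw [← Real.norm_eq_abs]
  refine norm_integral_le_of_norm_le ((integrableOn_exp_mul_rpow hb N hu).const_mul _) ?_
  filter_upwards [ae_restrict_mem measurableSet_Ioi] with y (hy : 0 < y)
  have h := abs_linnikJump_sub_le hb hb1 hν hN hy.le
  have h' : Real.exp (-(u * y)) * linnikJump b ν y -
      ∑ j ∈ Finset.Ico 1 N, a j * (Real.exp (-(u * y)) * y ^ (b * j)) =
      Real.exp (-(u * y)) * (linnikJump b ν y - ∑ j ∈ Finset.Ico 1 N, a j * y ^ (b * j)) := by
    rw [mul_sub, Finset.mul_sum]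
    congr 1
    exact Finset.sum_congr rfl fun j _ => by ring
  rw [h', norm_mul, Real.norm_of_nonneg (Real.exp_pos _).le, mul_left_comm]
  exact mul_le_mul_of_nonneg_left h (Real.exp_pos _).le

end Mixing

/-! ### The radial profile as a Gaussian mixture, and its expansion -/

/-- The Gaussian kernel `(4 π u) ^ (-n / 2) * exp (-r ^ 2 / (4 u))` on `ℝⁿ` at distance `r`. -/
noncomputable def heatProfile (n : ℕ) (u r : ℝ) : ℝ :=
  (4 * Real.pi * u) ^ (-((n : ℝ) / 2)) * Real.exp (-(r ^ 2 / (4 * u)))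

/-- The radial profile of the Linnik density, as a mixture of Gaussian kernels. -/
noncomputable def linnikProfile (b ν : ℝ) (n : ℕ) (r : ℝ) : ℝ :=
  ∫ u in Ioi 0, heatProfile n u r * linnikMixing b ν u

lemma measurable_heatProfile (n : ℕ) : Measurable (Function.uncurry (heatProfile n)) := by
  unfold heatProfile Function.uncurry
  fun_prop

lemma heatProfile_nonneg (n : ℕ) {u : ℝ} (hu : 0 ≤ u) (r : ℝ) : 0 ≤ heatProfile n u r := by
  unfold heatProfile
  positivity

section Profile

variable {b ν : ℝ}

lemma heatProfile_mul_rpow (n j : ℕ) (b r : ℝ) {u : ℝ} (hu : 0 < u) :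
    heatProfile n u r * u ^ (-(b * j) - 1) = (4 * Real.pi) ^ (-((n : ℝ) / 2)) *
      (u ^ (-((n : ℝ) / 2 + b * j) - 1) * Real.exp (-((r ^ 2 / 4) / u))) := by
  rw [heatProfile, Real.mul_rpow (by positivity) hu.le, div_div,
    show -((n : ℝ) / 2 + b * j) - 1 = -((n : ℝ) / 2) + (-(b * j) - 1) by ring, Real.rpow_add hu]
  ring

lemma integrableOn_heatProfile_mul_rpow (hb : 0 < b) {n : ℕ} (hn : 1 ≤ n) (j : ℕ) {r : ℝ}
    (hr : 0 < r) : IntegrableOn (fun u => heatProfile n u r * u ^ (-(b * j) - 1)) (Ioi 0) := by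
  have hn' : (0 : ℝ) < n := by exact_mod_cast hn
  have h := (integrableOn_rpow_mul_exp_neg_div (by positivity : 0 < (n : ℝ) / 2 + b * j)
    (by positivity : 0 < r ^ 2 / 4)).const_mul ((4 * Real.pi) ^ (-((n : ℝ) / 2)))
  exact IntegrableOn.congr_fun h (fun u hu => (heatProfile_mul_rpow n j b r hu).symm)
    measurableSet_Ioi

/-- The substitution `u ↦ 1 / u` gives a Gamma integral; the powers `2 ^ n` from `(4π) ^ (-n / 2)`
and `(r ^ 2 / 4) ^ (-n / 2)` cancel. -/
lemma integral_heatProfile_mul_rpow (hb : 0 < b) {n : ℕ} (hn : 1 ≤ n) (j : ℕ) {r : ℝ}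
    (hr : 0 < r) : ∫ u in Ioi 0, heatProfile n u r * u ^ (-(b * j) - 1) =
      Real.pi ^ (-((n : ℝ) / 2)) * 2 ^ (2 * b * j) * Real.Gamma ((n : ℝ) / 2 + b * j) *
        r ^ (-(2 * b) * j - n) := by
  have hn' : (0 : ℝ) < n := by exact_mod_cast hn
  rw [setIntegral_congr_fun measurableSet_Ioi fun u hu => heatProfile_mul_rpow n j b r hu,
    integral_const_mul, integral_rpow_mul_exp_neg_div (by positivity) (by positivity)]
  have h4 : (4 : ℝ) = 2 ^ (2 : ℝ) := by norm_num
  have h1 : (4 * Real.pi) ^ (-((n : ℝ) / 2)) = 2 ^ (-(n : ℝ)) * Real.pi ^ (-((n : ℝ) / 2)) := by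
    rw [Real.mul_rpow (by norm_num) Real.pi_pos.le, h4, ← Real.rpow_mul (by norm_num)]
    congr 2
    ring
  have h2 : (r ^ 2 / 4) ^ (-((n : ℝ) / 2 + b * j)) =
      r ^ (-(2 * b) * j - n) * (2 ^ (n : ℝ) * 2 ^ (2 * b * j)) := by
    rw [Real.div_rpow (by positivity) (by norm_num), ← Real.rpow_natCast r 2,
      ← Real.rpow_mul hr.le, h4, ← Real.rpow_mul (by norm_num), div_eq_mul_inv,
      ← Real.rpow_neg (by norm_num), ← Real.rpow_add (by norm_num)]
    congr 2 <;> push_cast <;> ring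
  have h3 : (2 : ℝ) ^ (-(n : ℝ)) * 2 ^ (n : ℝ) = 1 := by
    rw [← Real.rpow_add (by norm_num), neg_add_cancel, Real.rpow_zero]
  rw [h1, h2]
  linear_combination (Real.pi ^ (-((n : ℝ) / 2)) * 2 ^ (2 * b * j) *
    Real.Gamma ((n : ℝ) / 2 + b * j) * r ^ (-(2 * b) * j - n)) * h3

lemma abs_linnikMixing_le (hb : 0 < b) (hb1 : b < 1) (hν : 0 < ν) {u : ℝ} (hu : 0 < u) :
    |linnikMixing b ν u| ≤
      Real.pi⁻¹ * (negBinomCoeff ν 1 / Real.sin (Real.pi * b) ^ (ν + (1 : ℕ))) *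
        (Real.Gamma (b * (1 : ℕ) + 1) * u ^ (-(b * (1 : ℕ)) - 1)) := by
  simpa using abs_linnikMixing_sub_le hb hb1 hν le_rfl hu

lemma integrableOn_heatProfile_mul_linnikMixing (hb : 0 < b) (hb1 : b < 1) (hν : 0 < ν) {n : ℕ}
    (hn : 1 ≤ n) {r : ℝ} (hr : 0 < r) :
    IntegrableOn (fun u => heatProfile n u r * linnikMixing b ν u) (Ioi 0) := by
  have hm := measurable_heatProfile n
  refine Integrable.mono' ((integrableOn_heatProfile_mul_rpow hb hn 1 hr).const_mul
    (Real.pi⁻¹ * (negBinomCoeff ν 1 / Real.sin (Real.pi * b) ^ (ν + (1 : ℕ))) *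
      Real.Gamma (b * (1 : ℕ) + 1))) (AEStronglyMeasurable.mul
        (hm.comp (measurable_id.prodMk measurable_const)).aestronglyMeasurable
        (integrableOn_linnikMixing hb hb1 hν).aestronglyMeasurable) ?_
  filter_upwards [ae_restrict_mem measurableSet_Ioi] with u (hu : 0 < u)
  have h := abs_linnikMixing_le hb hb1 hν hu
  rw [norm_mul, Real.norm_of_nonneg (heatProfile_nonneg n hu.le r), Real.norm_eq_abs]
  refine (mul_le_mul_of_nonneg_left h (heatProfile_nonneg n hu.le r)).trans_eq ?_
  ring

/-- The heat kernel decreases in the radius, so its value at `r / 2` dominates near `r`. -/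
lemma continuousOn_linnikProfile (hb : 0 < b) (hb1 : b < 1) (hν : 0 < ν) {n : ℕ} (hn : 1 ≤ n) :
    ContinuousOn (linnikProfile b ν n) (Ioi 0) := by
  intro r (hr : 0 < r)
  refine ContinuousAt.continuousWithinAt ?_
  have hr2 : 0 < r / 2 := by positivity
  refine tendsto_integral_filter_of_dominated_convergence
    (fun u => ‖heatProfile n u (r / 2) * linnikMixing b ν u‖) ?_ ?_
    (integrableOn_heatProfile_mul_linnikMixing hb hb1 hν hn hr2).norm
    (Eventually.of_forall fun u => ?_)
  · filter_upwards [eventually_gt_nhds hr] with s hs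
    exact (integrableOn_heatProfile_mul_linnikMixing hb hb1 hν hn hs).aestronglyMeasurable
  · filter_upwards [eventually_ge_nhds (by linarith : r / 2 < r)] with s hs
    filter_upwards [ae_restrict_mem measurableSet_Ioi] with u (hu : 0 < u)
    rw [norm_mul, norm_mul, Real.norm_of_nonneg (heatProfile_nonneg n hu.le _),
      Real.norm_of_nonneg (heatProfile_nonneg n hu.le _)]
    unfold heatProfile
    gcongr
  · refine Tendsto.mul_const _ (Continuous.tendsto ?_ r)
    unfold heatProfile
    fun_prop

lemma linnikCoeff_mul_eq (ν : ℝ) {α : ℝ} (hα : 0 < α) {n : ℕ} (hn : 1 ≤ n) (j : ℕ) {r : ℝ}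
    (hr : 0 < r) :
    linnikCoeff α ν n j * r ^ (-α * j - n) = Real.pi⁻¹ *
      ((-1) ^ (j - 1) * negBinomCoeff ν j * Real.sin (Real.pi * (α / 2) * j)) *
        Real.Gamma (α / 2 * j + 1) * ∫ u in Ioi 0, heatProfile n u r * u ^ (-(α / 2 * j) - 1) := by
  rw [integral_heatProfile_mul_rpow (by positivity) hn j hr, linnikCoeff, negBinomCoeff,
    show ((n : ℝ) + 2) / 2 = n / 2 + 1 by ring, Real.rpow_add Real.pi_pos, Real.rpow_one,
    Real.rpow_neg Real.pi_pos.le, show (2 + α * j) / 2 = α / 2 * j + 1 by ring,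
    show ((n : ℝ) + α * j) / 2 = n / 2 + α / 2 * j by ring,
    show Real.pi * α * j / 2 = Real.pi * (α / 2) * j by ring, show 2 * (α / 2) = α by ring]
  field_simp

lemma linnikRemainderConst_mul_eq (ν : ℝ) {α : ℝ} (hα : 0 < α) {n : ℕ} (hn : 1 ≤ n) (N : ℕ)
    {r : ℝ} (hr : 0 < r) :
    linnikRemainderConst α ν n N * r ^ (-α * N - n) = Real.pi⁻¹ *
      (negBinomCoeff ν N / Real.sin (Real.pi * (α / 2)) ^ (ν + N)) *
        Real.Gamma (α / 2 * N + 1) * ∫ u in Ioi 0, heatProfile n u r * u ^ (-(α / 2 * N) - 1) := by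
  rw [integral_heatProfile_mul_rpow (by positivity) hn N hr, linnikRemainderConst, negBinomCoeff,
    show ((n : ℝ) + 2) / 2 = n / 2 + 1 by ring, Real.rpow_add Real.pi_pos, Real.rpow_one,
    Real.rpow_neg Real.pi_pos.le, show (2 + α * N) / 2 = α / 2 * N + 1 by ring,
    show ((n : ℝ) + α * N) / 2 = n / 2 + α / 2 * N by ring,
    show Real.pi * α / 2 = Real.pi * (α / 2) by ring, show 2 * (α / 2) = α by ring,
    add_comm (N : ℝ) ν]
  simp only [div_eq_mul_inv, mul_inv]
  ring

lemma abs_linnikProfile_sub_le {α : ℝ} (hα : 0 < α) (hα2 : α < 2) (hν : 0 < ν) {n : ℕ}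
    (hn : 1 ≤ n) {N : ℕ} (hN : 1 ≤ N) {r : ℝ} (hr : 0 < r) :
    |linnikProfile (α / 2) ν n r - ∑ j ∈ Finset.Ico 1 N, linnikCoeff α ν n j * r ^ (-α * j - n)| ≤
      linnikRemainderConst α ν n N * r ^ (-α * N - n) := by
  have hb : 0 < α / 2 := by positivity
  have hb1 : α / 2 < 1 := by linarith
  have hterm := fun j : ℕ => (integrableOn_heatProfile_mul_rpow hb hn j hr).const_mul
    (Real.pi⁻¹ * ((-1) ^ (j - 1) * negBinomCoeff ν j * Real.sin (Real.pi * (α / 2) * j)) *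
      Real.Gamma (α / 2 * j + 1))
  have hq := integrableOn_heatProfile_mul_linnikMixing hb hb1 hν hn hr
  simp only [linnikCoeff_mul_eq ν hα hn _ hr, ← integral_const_mul]
  rw [linnikRemainderConst_mul_eq ν hα hn N hr, ← integral_const_mul, linnikProfile,
    ← integral_finsetSum _ fun j _ => hterm j,
    ← integral_sub hq (integrable_finsetSum _ fun j _ => hterm j), ← Real.norm_eq_abs]
  refine norm_integral_le_of_norm_le
    ((integrableOn_heatProfile_mul_rpow hb hn N hr).const_mul _) ?_
  filter_upwards [ae_restrict_mem measurableSet_Ioi] with u (hu : 0 < u)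
  have h0 := heatProfile_nonneg n hu.le r
  have h := mul_le_mul_of_nonneg_left (abs_linnikMixing_sub_le hb hb1 hν hN hu) h0
  rw [← abs_of_nonneg h0, ← abs_mul, abs_of_nonneg h0, mul_sub, Finset.mul_sum] at h
  rw [Real.norm_eq_abs]
  refine le_trans (le_of_eq ?_) (h.trans_eq (by ring))
  congr 2
  exact Finset.sum_congr rfl fun j _ => by ring

end Profile

/-! ### Fourier transform of the heat kernel -/

section Gaussian

variable {n : ℕ}

lemma heatProfile_mul_cexp_eq (u : ℝ) (t x : EuclideanSpace ℝ (Fin n)) :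
    (heatProfile n u ‖x‖ : ℂ) * Complex.exp (inner ℝ x t * Complex.I) =
      ((4 * Real.pi * u) ^ (-((n : ℝ) / 2)) : ℝ) *
        Complex.exp (-((1 / (4 * u) : ℝ) : ℂ) * ‖x‖ ^ 2 + Complex.I * inner ℝ t x) := by
  rw [heatProfile, Complex.exp_add, Complex.ofReal_mul, Complex.ofReal_exp, mul_assoc,
    real_inner_comm, mul_comm Complex.I]
  congr 3
  push_cast
  ring

lemma integrable_heatProfile_mul_cexp {u : ℝ} (hu : 0 < u) (t : EuclideanSpace ℝ (Fin n)) :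
    Integrable fun x : EuclideanSpace ℝ (Fin n) =>
      (heatProfile n u ‖x‖ : ℂ) * Complex.exp (inner ℝ x t * Complex.I) := by
  simp only [heatProfile_mul_cexp_eq u]
  exact (GaussianFourier.integrable_cexp_neg_mul_sq_norm_add
    (by rw [Complex.ofReal_re]; positivity) _ _).const_mul _

lemma integral_heatProfile_mul_cexp {u : ℝ} (hu : 0 < u) (t : EuclideanSpace ℝ (Fin n)) :
    ∫ x : EuclideanSpace ℝ (Fin n),
      (heatProfile n u ‖x‖ : ℂ) * Complex.exp (inner ℝ x t * Complex.I) =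
        (Real.exp (-(‖t‖ ^ 2 * u)) : ℝ) := by
  have hu' : (u : ℂ) ≠ 0 := by exact_mod_cast hu.ne'
  simp only [heatProfile_mul_cexp_eq u]
  rw [integral_const_mul, GaussianFourier.integral_cexp_neg_mul_sq_norm_add
    (by rw [Complex.ofReal_re]; positivity), finrank_euclideanSpace_fin]
  have h1 : ((Real.pi : ℂ) / ((1 / (4 * u) : ℝ) : ℂ)) ^ ((n : ℂ) / 2) =
      (((4 * Real.pi * u) ^ ((n : ℝ) / 2) : ℝ) : ℂ) := by
    rw [Complex.ofReal_cpow (by positivity)]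
    push_cast
    congr 1
    field_simp
  have h2 : (4 * Real.pi * u) ^ (-((n : ℝ) / 2)) * (4 * Real.pi * u) ^ ((n : ℝ) / 2) = 1 := by
    rw [← Real.rpow_add (by positivity), neg_add_cancel, Real.rpow_zero]
  rw [h1, ← mul_assoc, ← Complex.ofReal_mul, h2, Complex.ofReal_one, one_mul, Complex.I_sq]
  push_cast
  congr 1
  field_simp

lemma integrable_heatProfile {u : ℝ} (hu : 0 < u) :
    Integrable fun x : EuclideanSpace ℝ (Fin n) => heatProfile n u ‖x‖ := by
  have h := (integrable_heatProfile_mul_cexp hu (0 : EuclideanSpace ℝ (Fin n))).re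
  simpa using h

lemma integral_heatProfile {u : ℝ} (hu : 0 < u) :
    ∫ x : EuclideanSpace ℝ (Fin n), heatProfile n u ‖x‖ = 1 := by
  have h := integral_heatProfile_mul_cexp hu (0 : EuclideanSpace ℝ (Fin n))
  simp only [inner_zero_right, Complex.ofReal_zero, zero_mul, Complex.exp_zero, mul_one,
    norm_zero, ne_eq, OfNat.ofNat_ne_zero, not_false_eq_true, zero_pow, neg_zero, Real.exp_zero,
    integral_complex_ofReal] at h
  exact_mod_cast h

end Gaussian

/-! ### Characteristic function and positivity of the mixture -/

section Fourier

variable {b ν : ℝ} {n : ℕ}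

lemma integrable_heatProfile_mul_linnikMixing_prod (hb : 0 < b) (hb1 : b < 1) (hν : 0 < ν) :
    Integrable (fun p : EuclideanSpace ℝ (Fin n) × ℝ => heatProfile n p.2 ‖p.1‖ * linnikMixing b ν p.2)
      (volume.prod (volume.restrict (Ioi 0))) := by
  have hm := measurable_heatProfile n
  have hg := integrableOn_linnikMixing hb hb1 hν
  have hms : AEStronglyMeasurable (fun p : EuclideanSpace ℝ (Fin n) × ℝ =>
      heatProfile n p.2 ‖p.1‖ * linnikMixing b ν p.2) (volume.prod (volume.restrict (Ioi 0))) :=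
    (hm.comp (measurable_snd.prodMk measurable_fst.norm)).aestronglyMeasurable.mul
      hg.aestronglyMeasurable.comp_snd
  rw [integrable_prod_iff' hms]
  constructor
  · filter_upwards [ae_restrict_mem measurableSet_Ioi] with u (hu : 0 < u)
    exact (integrable_heatProfile hu).mul_const _
  · refine hg.norm.congr ?_
    filter_upwards [ae_restrict_mem measurableSet_Ioi] with u (hu : 0 < u)
    simp only [norm_mul, Real.norm_of_nonneg (heatProfile_nonneg n hu.le _)]
    rw [integral_mul_const, integral_heatProfile hu, one_mul]

lemma integrable_linnikProfile (hb : 0 < b) (hb1 : b < 1) (hν : 0 < ν) :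
    Integrable fun x : EuclideanSpace ℝ (Fin n) => linnikProfile b ν n ‖x‖ :=
  (integrable_heatProfile_mul_linnikMixing_prod hb hb1 hν).integral_prod_left

lemma integral_linnikProfile_mul_cexp {α : ℝ} (hα : 0 < α) (hα2 : α < 2) (hν : 0 < ν)
    (t : EuclideanSpace ℝ (Fin n)) :
    ∫ x : EuclideanSpace ℝ (Fin n),
      (linnikProfile (α / 2) ν n ‖x‖ : ℂ) * Complex.exp (inner ℝ x t * Complex.I) =
        linnikCharFun α ν n t := by
  have hb : 0 < α / 2 := by positivity
  have hb1 : α / 2 < 1 := by linarith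
  have hint : Integrable (Function.uncurry fun (x : EuclideanSpace ℝ (Fin n)) (u : ℝ) =>
      Complex.exp (inner ℝ x t * Complex.I) *
        ((heatProfile n u ‖x‖ * linnikMixing (α / 2) ν u : ℝ) : ℂ))
      (volume.prod (volume.restrict (Ioi 0))) := by
    refine Integrable.bdd_mul (c := 1)
      (integrable_heatProfile_mul_linnikMixing_prod hb hb1 hν).ofReal
      (Continuous.aestronglyMeasurable (by fun_prop)) (Eventually.of_forall fun p => ?_)
    rw [Complex.norm_exp_ofReal_mul_I]
  have h1 : ∀ x : EuclideanSpace ℝ (Fin n),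
      (linnikProfile (α / 2) ν n ‖x‖ : ℂ) * Complex.exp (inner ℝ x t * Complex.I) =
        ∫ u in Ioi 0, Complex.exp (inner ℝ x t * Complex.I) *
          ((heatProfile n u ‖x‖ * linnikMixing (α / 2) ν u : ℝ) : ℂ) := fun x => by
    rw [integral_const_mul, integral_complex_ofReal, linnikProfile, mul_comm]
  have h2 : ∀ u ∈ Ioi (0 : ℝ), ∫ x : EuclideanSpace ℝ (Fin n),
      Complex.exp (inner ℝ x t * Complex.I) *
        ((heatProfile n u ‖x‖ * linnikMixing (α / 2) ν u : ℝ) : ℂ) =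
      ((Real.exp (-(‖t‖ ^ 2 * u)) * linnikMixing (α / 2) ν u : ℝ) : ℂ) := fun u hu => by
    rw [Complex.ofReal_mul, ← integral_heatProfile_mul_cexp hu t, ← integral_mul_const]
    congr 1
    ext x
    push_cast
    ring
  simp only [h1]
  rw [integral_integral_swap hint, setIntegral_congr_fun measurableSet_Ioi h2,
    integral_complex_ofReal, integral_exp_mul_linnikMixing hb hb1 hν (by positivity),
    linnikCharFun, ← Real.rpow_natCast ‖t‖ 2, ← Real.rpow_mul (norm_nonneg t), Real.rpow_neg
    (by positivity), one_div]
  congr 5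
  push_cast
  ring

lemma charFun_withDensity_ofReal {f : EuclideanSpace ℝ (Fin n) → ℝ} (hf : AEMeasurable f)
    (t : EuclideanSpace ℝ (Fin n)) :
    charFun (volume.withDensity fun x => ENNReal.ofReal (f x)) t =
      ∫ x, ((max (f x) 0 : ℝ) : ℂ) * Complex.exp (inner ℝ x t * Complex.I) := by
  rw [charFun_apply, integral_withDensity_eq_integral_toReal_smul₀ hf.ennreal_ofReal
    (Eventually.of_forall fun _ => ENNReal.ofReal_lt_top)]
  simp only [ENNReal.toReal_ofReal', Complex.real_smul]

/-- The measures `f⁺ dx` and `μ + f⁻ dx` have the same characteristic function, hence coincide. So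
`f⁻ ≤ f⁺` almost everywhere, which rules out negative values. -/
lemma ae_nonneg_of_integral_mul_cexp_eq_charFun {f : EuclideanSpace ℝ (Fin n) → ℝ}
    (hf : Integrable f) (μ : Measure (EuclideanSpace ℝ (Fin n))) [IsFiniteMeasure μ]
    (h : ∀ t, ∫ x, (f x : ℂ) * Complex.exp (inner ℝ x t * Complex.I) = charFun μ t) :
    ∀ᵐ x, 0 ≤ f x := by
  have hfin1 := isFiniteMeasure_withDensity_ofReal hf.hasFiniteIntegral
  have hfin2 := isFiniteMeasure_withDensity_ofReal hf.neg.hasFiniteIntegral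
  have hexp : ∀ (m : Measure (EuclideanSpace ℝ (Fin n))) [IsFiniteMeasure m]
      (t : EuclideanSpace ℝ (Fin n)),
      Integrable (fun x => Complex.exp (inner ℝ x t * Complex.I)) m := fun m _ t =>
    Integrable.of_bound (Continuous.aestronglyMeasurable (by fun_prop)) 1
      (Eventually.of_forall fun x => (Complex.norm_exp_ofReal_mul_I _).le)
  have hmul : ∀ {g : EuclideanSpace ℝ (Fin n) → ℝ} (t : EuclideanSpace ℝ (Fin n)),
      Integrable g → Integrable fun x => (g x : ℂ) * Complex.exp (inner ℝ x t * Complex.I) :=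
    fun t hg => Integrable.mul_bdd (c := 1) hg.ofReal
      (Continuous.aestronglyMeasurable (by fun_prop))
      (Eventually.of_forall fun x => (Complex.norm_exp_ofReal_mul_I _).le)
  have heq : (volume.withDensity fun x => ENNReal.ofReal (f x)) =
      μ + volume.withDensity fun x => ENNReal.ofReal ((-f) x) := by
    refine Measure.ext_of_charFun (funext fun t => ?_)
    rw [charFun_apply (μ := μ + _), integral_add_measure (hexp _ t) (hexp _ t), ← charFun_apply,
      ← charFun_apply, charFun_withDensity_ofReal hf.aemeasurable,
      charFun_withDensity_ofReal hf.neg.aemeasurable, ← h t,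
      ← integral_add (hmul t hf) (hmul t hf.neg.pos_part)]
    congr 1
    ext x
    rw [← add_mul, ← Complex.ofReal_add, Pi.neg_apply]
    congr 2
    rcases le_total 0 (f x) with hx | hx <;> simp [hx]
  have hle : (fun x => ENNReal.ofReal ((-f) x)) ≤ᵐ[volume] fun x => ENNReal.ofReal (f x) := by
    refine ae_le_of_forall_setLIntegral_le_of_sigmaFinite₀
      hf.neg.aemeasurable.ennreal_ofReal fun s hs _ => ?_
    rw [← withDensity_apply _ hs, ← withDensity_apply _ hs, heq, Measure.add_apply]
    exact le_add_self
  filter_upwards [hle] with x hx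
  by_contra! hneg
  rw [ENNReal.ofReal_of_nonpos hneg.le, nonpos_iff_eq_zero, ENNReal.ofReal_eq_zero,
    Pi.neg_apply] at hx
  linarith

lemma isLinnikDensity_linnikProfile_of_nonneg {α : ℝ} (hα : 0 < α) (hα2 : α < 2) (hν : 0 < ν)
    (h : ∀ᵐ x : EuclideanSpace ℝ (Fin n), 0 ≤ linnikProfile (α / 2) ν n ‖x‖) :
    IsLinnikDensity α ν n fun x => linnikProfile (α / 2) ν n ‖x‖ := by
  have hint := integrable_linnikProfile (n := n) (by positivity : 0 < α / 2) (by linarith) hν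
  refine ⟨hint.aemeasurable, h, fun t => ?_⟩
  rw [charFun_withDensity_ofReal hint.aemeasurable, ← integral_linnikProfile_mul_cexp hα hα2 hν]
  refine integral_congr_ae ?_
  filter_upwards [h] with x hx
  rw [max_eq_left hx]

/-- The exponent `k` counts halvings down to `ν ≤ 1`, where the mixing density is nonnegative. Going
back up, the self-convolution of the law for `ν / 2` is a positive measure with the required
characteristic function. -/
lemma linnikProfile_ae_nonneg {α : ℝ} (hα : 0 < α) (hα2 : α < 2) (k : ℕ) {ν : ℝ} (hν : 0 < ν)
    (hk : ν ≤ 2 ^ k) :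
    ∀ᵐ x : EuclideanSpace ℝ (Fin n), 0 ≤ linnikProfile (α / 2) ν n ‖x‖ := by
  have hb : 0 < α / 2 := by positivity
  have hb1 : α / 2 < 1 := by linarith
  induction k generalizing ν with
  | zero =>
    refine Eventually.of_forall fun x => setIntegral_nonneg measurableSet_Ioi fun u hu => ?_
    exact mul_nonneg (heatProfile_nonneg n (le_of_lt hu) _)
      (linnikMixing_nonneg hb hb1 hν (by simpa using hk) u)
  | succ k ih =>
    have hν2 : 0 < ν / 2 := by positivity
    have hd := isLinnikDensity_linnikProfile_of_nonneg (n := n) hα hα2 hν2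
      (ih hν2 (by rw [pow_succ] at hk; linarith))
    set m := (volume : Measure (EuclideanSpace ℝ (Fin n))).withDensity fun x =>
      ENNReal.ofReal (linnikProfile (α / 2) (ν / 2) n ‖x‖)
    have : IsFiniteMeasure m := isFiniteMeasure_withDensity_ofReal
      (integrable_linnikProfile hb hb1 hν2).hasFiniteIntegral
    refine ae_nonneg_of_integral_mul_cexp_eq_charFun (integrable_linnikProfile hb hb1 hν)
      (m.conv m) fun t => ?_
    rw [integral_linnikProfile_mul_cexp hα hα2 hν, charFun_conv, hd.charFun_eq t,
      ← Complex.ofReal_mul]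
    congr 1
    have hpos : 0 < 1 + ‖t‖ ^ α := by positivity
    rw [linnikCharFun, linnikCharFun, div_mul_div_comm, one_mul, ← Real.rpow_add hpos, add_halves]

lemma isLinnikRadialDensity_linnikProfile {α : ℝ} (hα : 0 < α) (hα2 : α < 2) (hν : 0 < ν)
    (hn : 1 ≤ n) : IsLinnikRadialDensity α ν n (linnikProfile (α / 2) ν n) := by
  obtain ⟨k, hk⟩ := pow_unbounded_of_one_lt ν (one_lt_two (α := ℝ))
  exact ⟨continuousOn_linnikProfile (by positivity) (by linarith) hν hn,
    isLinnikDensity_linnikProfile_of_nonneg hα hα2 hν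
      (linnikProfile_ae_nonneg hα hα2 k hν hk.le)⟩

end Fourier

/-! ### Uniqueness of the density and of its profile -/

section Uniqueness

variable {α ν : ℝ} {n : ℕ}

lemma IsLinnikDensity.isFiniteMeasure {p : EuclideanSpace ℝ (Fin n) → ℝ} (hα : α ≠ 0)
    (h : IsLinnikDensity α ν n p) :
    IsFiniteMeasure (volume.withDensity fun x => ENNReal.ofReal (p x)) := by
  have h0 := h.charFun_eq 0
  rw [charFun_zero, linnikCharFun, norm_zero, Real.zero_rpow hα, add_zero, Real.one_rpow,
    div_one, Complex.ofReal_inj, Measure.real] at h0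
  -- An infinite mass would have real value `0`, whereas the characteristic function at `0` is `1`.
  refine ⟨lt_top_iff_ne_top.2 fun htop => ?_⟩
  rw [htop] at h0
  simp at h0

lemma IsLinnikDensity.ae_eq {p₁ p₂ : EuclideanSpace ℝ (Fin n) → ℝ} (hα : α ≠ 0)
    (h₁ : IsLinnikDensity α ν n p₁) (h₂ : IsLinnikDensity α ν n p₂) : p₁ =ᵐ[volume] p₂ := by
  have := h₁.isFiniteMeasure hα
  have := h₂.isFiniteMeasure hα
  have heq : (volume.withDensity fun x => ENNReal.ofReal (p₁ x)) =
      volume.withDensity fun x => ENNReal.ofReal (p₂ x) :=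
    Measure.ext_of_charFun (funext fun t => (h₁.charFun_eq t).trans (h₂.charFun_eq t).symm)
  rw [withDensity_eq_iff_of_sigmaFinite h₁.aemeasurable.ennreal_ofReal
    h₂.aemeasurable.ennreal_ofReal] at heq
  filter_upwards [heq, h₁.nonneg, h₂.nonneg] with x hx hx1 hx2
  exact (ENNReal.ofReal_eq_ofReal_iff hx1 hx2).1 hx

/-- Continuous functions that agree almost everywhere agree on the open complement of the origin,
and for `n ≥ 1` every `r > 0` is a norm. -/
lemma IsLinnikRadialDensity.eqOn {q₁ q₂ : ℝ → ℝ} (hα : α ≠ 0) (hn : 1 ≤ n)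
    (h₁ : IsLinnikRadialDensity α ν n q₁) (h₂ : IsLinnikRadialDensity α ν n q₂) :
    EqOn q₁ q₂ (Ioi 0) := by
  have hnt : Nonempty (Fin n) := ⟨⟨0, hn⟩⟩
  have hmaps : MapsTo (fun x : EuclideanSpace ℝ (Fin n) => ‖x‖) {0}ᶜ (Ioi 0) := fun x hx =>
    norm_pos_iff.2 hx
  have h := Measure.eqOn_open_of_ae_eq
    (ae_restrict_of_ae (h₁.isLinnikDensity.ae_eq hα h₂.isLinnikDensity))
    (isOpen_compl_singleton (x := (0 : EuclideanSpace ℝ (Fin n))))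
    (h₁.continuousOn.comp continuous_norm.continuousOn hmaps)
    (h₂.continuousOn.comp continuous_norm.continuousOn hmaps)
  intro r (hr : 0 < r)
  obtain ⟨x, hx⟩ := exists_norm_eq (EuclideanSpace ℝ (Fin n)) hr.le
  have hx0 : x ≠ 0 := fun h0 => by
    rw [h0, norm_zero] at hx
    exact hr.ne hx
  simpa only [hx] using h hx0

end Uniqueness

/-! ### Leading asymptotics and conclusion -/

lemma isEquivalent_of_abs_sub_le {f : ℝ → ℝ} {A B s t : ℝ} (hA : A ≠ 0) (hst : s < t)
    (h : ∀ r : ℝ, 0 < r → |f r - A * r ^ (-t)| ≤ B * r ^ (-(t + (t - s)))) :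
    Asymptotics.IsEquivalent atTop f fun r => A * r ^ (-t) := by
  have h1 : (fun r => f r - A * r ^ (-t)) =O[atTop] fun r : ℝ => r ^ (-(t - s)) * r ^ (-t) := by
    refine Asymptotics.IsBigO.of_bound B ?_
    filter_upwards [eventually_gt_atTop 0] with r hr
    rw [Real.norm_eq_abs, ← Real.rpow_add hr, Real.norm_of_nonneg (by positivity)]
    exact (h r hr).trans_eq (by congr 2; ring)
  have h2 : (fun r : ℝ => r ^ (-(t - s)) * r ^ (-t)) =o[atTop] fun r : ℝ => r ^ (-t) := by
    have h0 : (fun r : ℝ => r ^ (-(t - s))) =o[atTop] fun _ => (1 : ℝ) :=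
      (Asymptotics.isLittleO_one_iff ℝ).2 (tendsto_rpow_neg_atTop (by linarith))
    simpa using h0.mul_isBigO (Asymptotics.isBigO_refl (fun r : ℝ => r ^ (-t)) atTop)
  exact (h1.trans_isLittleO h2).trans_isBigO
    (Asymptotics.isBigO_const_mul_self A⁻¹ _ _ |>.congr_left fun r => inv_mul_cancel_left₀ hA _)

lemma linnikCoeff_one {α ν : ℝ} (hν : 0 < ν) (n : ℕ) :
    linnikCoeff α ν n 1 = 2 ^ α * ν / Real.pi ^ (((n : ℝ) + 2) / 2) * Real.sin (Real.pi * α / 2) *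
      Real.Gamma ((n + α) / 2) * Real.Gamma ((2 + α) / 2) := by
  have hG : Real.Gamma (ν + 1) / Real.Gamma ν = ν := by
    rw [Real.Gamma_add_one hν.ne', mul_div_cancel_right₀ _ (Real.Gamma_pos_of_pos hν).ne']
  simp only [linnikCoeff, Nat.cast_one, mul_one, hG, Nat.sub_self, pow_zero, Nat.factorial_one,
    div_one]
  ring

lemma linnikCoeff_one_pos {α ν : ℝ} (hα : 0 < α) (hα2 : α < 2) (hν : 0 < ν) (n : ℕ) :
    0 < linnikCoeff α ν n 1 := by
  have h1 : 0 < Real.sin (Real.pi * α / 2) := by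
    rw [mul_div_assoc]
    exact sin_pi_mul_pos (by positivity) (by linarith)
  have h2 : 0 < Real.Gamma ((n + α) / 2) := Real.Gamma_pos_of_pos (by positivity)
  have h3 : 0 < Real.Gamma ((2 + α) / 2) := Real.Gamma_pos_of_pos (by positivity)
  rw [linnikCoeff_one hν]
  positivity

theorem mainTheorem3 (α ν : ℝ) (hα : 0 < α) (hα2 : α < 2) (hν : 0 < ν) (n : ℕ) (hn : 1 ≤ n) :
    (∃ q : ℝ → ℝ, IsLinnikRadialDensity α ν n q) ∧
    (∀ q₁ q₂ : ℝ → ℝ, IsLinnikRadialDensity α ν n q₁ → IsLinnikRadialDensity α ν n q₂ →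
      Set.EqOn q₁ q₂ (Set.Ioi 0)) ∧
    ∀ q : ℝ → ℝ, IsLinnikRadialDensity α ν n q →
      (∀ N : ℕ, 1 ≤ N → ∀ r : ℝ, 0 < r →
        |q r - ∑ j ∈ Finset.Ico 1 N, linnikCoeff α ν n j * r ^ (-α * j - n)| ≤
          linnikRemainderConst α ν n N * r ^ (-α * N - n)) ∧
      Asymptotics.IsEquivalent Filter.atTop q (fun r : ℝ =>
        2 ^ α * ν / Real.pi ^ (((n : ℝ) + 2) / 2) * Real.sin (Real.pi * α / 2) *
          Real.Gamma ((n + α) / 2) * Real.Gamma ((2 + α) / 2) * r ^ (-α - n)) := by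
  have hq₀ := isLinnikRadialDensity_linnikProfile hα hα2 hν hn
  refine ⟨⟨_, hq₀⟩, fun q₁ q₂ h₁ h₂ => h₁.eqOn hα.ne' hn h₂, fun q hq => ?_⟩
  have hbound : ∀ N : ℕ, 1 ≤ N → ∀ r : ℝ, 0 < r →
      |q r - ∑ j ∈ Finset.Ico 1 N, linnikCoeff α ν n j * r ^ (-α * j - n)| ≤
        linnikRemainderConst α ν n N * r ^ (-α * N - n) := fun N hN r hr => by
    rw [hq.eqOn hα.ne' hn hq₀ hr]
    exact abs_linnikProfile_sub_le hα hα2 hν hn hN hr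
  refine ⟨hbound, ?_⟩
  rw [← linnikCoeff_one hν]
  -- With `N = 2` only `j = 1` remains in the sum; taking `t = α + n` and `s = n` makes the error
  -- exponent `-(2α + n)`.
  have h := isEquivalent_of_abs_sub_le (f := q) (B := linnikRemainderConst α ν n 2)
    (linnikCoeff_one_pos hα hα2 hν n).ne' (by linarith : (n : ℝ) < α + n) fun r hr => by
      convert hbound 2 one_le_two r hr using 2
      · simp [show -α - (n : ℝ) = -n + -α by ring]
      · congr 1
        push_cast
        ring
  simpa only [neg_add'] using h
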